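/- Let $K\subseteq GL_n(\mathbb C)$ be a compact connected group and let $G\subseteq GL_n(\mathbb C)$ be its complexification, i.e. $G$ is a linear algebraic group (a Zariski-closed subgroup of $GL_n(\mathbb C)$) containing $K$ as a Zariski-dense subgroup. (Up to isomorphism, these $G$ are exactly the connected complex reductive groups, and $K$ is a maximal compact subgroup of $G$.) Let $\phi\colon G\to GL(V)$ be a rational representation on a finite-dimensional complex vector space $V$ with a $K$-invariant Hermitian inner product and the induced norm. Equip $V^{\otimes k}$ with the induced inner product, $\langle x_1\otimes\cdots\otimes x_k,\,y_1\otimes\cdots\otimes y_k\rangle=\prod_i\langle x_i,y_i\rangle$, and let $\Pi_k$ be the orthogonal projection of $V^{\otimes k}$ onto its subspace of vectors invariant under $\phi(g)^{\otimes k}$ for all $g\in G$. Then for every $v\in V$ $$\limsup_{k\to\infty}\,\bigl\|\Pi_k v^{\otimes k}\bigr\|^{1/k}=\inf_{g\in G}\|\phi(g)v\|,$$ and the right-hand side is the distance from the origin to the orbit closure $\overline{G\cdot v}$. -/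

import Mathlib

noncomputable section

/-! ### Complex reductive groups as complexifications of compact groups -/

section Groups

variable {n : ℕ}

/-- The value at `g ∈ GL_n(ℂ)` of a polynomial in the `n²` matrix entries. -/
def evalGL (p : MvPolynomial (Fin n × Fin n) ℂ) (g : Matrix.GeneralLinearGroup (Fin n) ℂ) : ℂ :=
  MvPolynomial.eval (fun ij => (g : Matrix (Fin n) (Fin n) ℂ) ij.1 ij.2) p

/-- `G` is a linear algebraic group: a subgroup of `GL_n(ℂ)` cut out by polynomial equations. -/
def IsLinearAlgebraic (G : Subgroup (Matrix.GeneralLinearGroup (Fin n) ℂ)) : Prop :=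
  ∃ I : Set (MvPolynomial (Fin n × Fin n) ℂ), ∀ g, g ∈ G ↔ ∀ p ∈ I, evalGL p g = 0

/-- `G` is the complexification of the compact group `K`: `K` is a compact subgroup of the linear
algebraic group `G`, and it is Zariski dense in `G`. -/
structure IsComplexification (K G : Subgroup (Matrix.GeneralLinearGroup (Fin n) ℂ)) : Prop where
  isCompact : IsCompact (K : Set (Matrix.GeneralLinearGroup (Fin n) ℂ))
  isLinearAlgebraic : IsLinearAlgebraic G
  le : K ≤ G
  zariskiDense : ∀ p : MvPolynomial (Fin n × Fin n) ℂ,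
    (∀ g ∈ K, evalGL p g = 0) → ∀ g ∈ G, evalGL p g = 0

/-- Regular functions on `G ⊆ GL_n(ℂ)`: restrictions of elements of `ℂ[x_{ij}, det⁻¹]`. -/
def IsRegularFun (G : Subgroup (Matrix.GeneralLinearGroup (Fin n) ℂ)) (f : G → ℂ) : Prop :=
  ∃ (p : MvPolynomial (Fin n × Fin n) ℂ) (m : ℕ), ∀ g : G,
    f g = evalGL p g.1 / (g.1 : Matrix (Fin n) (Fin n) ℂ).det ^ m

/-- A representation is rational if all of its matrix coefficients are regular functions. -/
def IsRationalRep {G : Subgroup (Matrix.GeneralLinearGroup (Fin n) ℂ)} {V : Type*}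
    [AddCommGroup V] [Module ℂ V] (φ : Representation ℂ G V) : Prop :=
  ∀ (l : Module.Dual ℂ V) (x : V), IsRegularFun G (fun g => l (φ g x))

end Groups

/-! ### The tensor powers of a finite-dimensional Hermitian space

Mathlib's `PiTensorProduct` carries the projective seminorm, hence the type synonym. -/

/-- The `k`-th tensor power `V^{⊗k}`. -/
def TensorPow (V : Type*) [AddCommGroup V] [Module ℂ V] (k : ℕ) : Type _ :=
  PiTensorProduct ℂ (fun _ : Fin k => V)

namespace TensorPow

section Algebra

variable {V : Type*} [AddCommGroup V] [Module ℂ V] {k : ℕ}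

instance : AddCommGroup (TensorPow V k) :=
  inferInstanceAs (AddCommGroup (PiTensorProduct ℂ (fun _ : Fin k => V)))

instance : Module ℂ (TensorPow V k) :=
  inferInstanceAs (Module ℂ (PiTensorProduct ℂ (fun _ : Fin k => V)))

instance [FiniteDimensional ℂ V] : FiniteDimensional ℂ (TensorPow V k) :=
  inferInstanceAs (FiniteDimensional ℂ (PiTensorProduct ℂ (fun _ : Fin k => V)))

/-- The pure tensor `x₁ ⊗ ⋯ ⊗ x_k`. -/
def pure (x : Fin k → V) : TensorPow V k := PiTensorProduct.tprod ℂ x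

/-- The tensor power representation `g ↦ φ(g) ⊗ ⋯ ⊗ φ(g)` on `V^{⊗k}`. -/
def rep {G : Type*} [Group G] (φ : Representation ℂ G V) (k : ℕ) :
    Representation ℂ G (TensorPow V k) where
  toFun g := PiTensorProduct.map (fun _ : Fin k => φ g)
  map_one' := by
    simp only [map_one]
    exact PiTensorProduct.map_one
  map_mul' g h := by
    simp only [map_mul]
    exact PiTensorProduct.map_mul (fun _ : Fin k => φ g) (fun _ : Fin k => φ h)

theorem rep_pure {G : Type*} [Group G] (φ : Representation ℂ G V) (g : G) (x : Fin k → V) :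
    rep φ k g (pure x) = pure (fun i => φ g (x i)) :=
  PiTensorProduct.map_tprod (R := ℂ) (fun _ : Fin k => φ g) x

end Algebra

section Hermitian

variable {V : Type*} [NormedAddCommGroup V] [InnerProductSpace ℂ V] [FiniteDimensional ℂ V] {k : ℕ}

/-- The basis of `V^{⊗k}` made of the pure tensors in an orthonormal basis of `V`. -/
def basis (V : Type*) [NormedAddCommGroup V] [InnerProductSpace ℂ V] [FiniteDimensional ℂ V]
    (k : ℕ) : Module.Basis (Fin k → Fin (Module.finrank ℂ V)) ℂ (TensorPow V k) :=
  Basis.piTensorProduct (fun _ : Fin k => (stdOrthonormalBasis ℂ V).toBasis)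

/-- The inner product on `V^{⊗k}` for which `basis V k` is orthonormal. It is the canonical one,
see `inner_pure`. -/
@[reducible]
def core (V : Type*) [NormedAddCommGroup V] [InnerProductSpace ℂ V] [FiniteDimensional ℂ V]
    (k : ℕ) : InnerProductSpace.Core ℂ (TensorPow V k) where
  inner x y := ∑ p, (starRingEnd ℂ) ((basis V k).repr x p) * (basis V k).repr y p
  conj_inner_symm x y := by
    rw [map_sum]
    refine Finset.sum_congr rfl fun p _ => ?_
    rw [map_mul, Complex.conj_conj, mul_comm]
  add_left x y z := by
    rw [← Finset.sum_add_distrib]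
    refine Finset.sum_congr rfl fun p _ => ?_
    rw [map_add, Finsupp.add_apply, map_add, add_mul]
  smul_left x y r := by
    rw [Finset.mul_sum]
    refine Finset.sum_congr rfl fun p _ => ?_
    rw [map_smul, Finsupp.smul_apply, smul_eq_mul, map_mul, mul_assoc]
  re_inner_nonneg x := by
    rw [map_sum]
    refine Finset.sum_nonneg fun p _ => ?_
    rw [← Complex.normSq_eq_conj_mul_self]
    exact Complex.normSq_nonneg _
  definite x h := by
    have h' : ∑ p, Complex.normSq ((basis V k).repr x p) = 0 := by
      have : ((∑ p, Complex.normSq ((basis V k).repr x p) : ℝ) : ℂ) = 0 := by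
        rw [← h, Complex.ofReal_sum]
        exact Finset.sum_congr rfl fun p _ => Complex.normSq_eq_conj_mul_self
      exact_mod_cast this
    rw [Finset.sum_eq_zero_iff_of_nonneg (fun _ _ => Complex.normSq_nonneg _)] at h'
    refine (basis V k).ext_elem fun p => ?_
    rw [map_zero, Finsupp.zero_apply]
    exact Complex.normSq_eq_zero.1 (h' p (Finset.mem_univ p))

instance : NormedAddCommGroup (TensorPow V k) :=
  (core V k).toNormedAddCommGroup

instance : InnerProductSpace ℂ (TensorPow V k) :=
  InnerProductSpace.ofCore (core V k).toCore

/-- The inner product on `V^{⊗k}` is the one induced from `V`. -/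
theorem inner_pure (x y : Fin k → V) :
    inner ℂ (pure x) (pure y) = ∏ i, inner ℂ (x i) (y i) := by
  have hrepr : ∀ (z : Fin k → V) (p : Fin k → Fin (Module.finrank ℂ V)),
      (basis V k).repr (pure z) p = ∏ i, inner ℂ (stdOrthonormalBasis ℂ V (p i)) (z i) := by
    intro z p
    refine (Basis.piTensorProduct_repr_tprod_apply
      (fun _ : Fin k => (stdOrthonormalBasis ℂ V).toBasis) z p).trans ?_
    simp [OrthonormalBasis.repr_apply_apply]
  change ∑ p, (starRingEnd ℂ) ((basis V k).repr (pure x) p) * (basis V k).repr (pure y) p = _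
  simp only [hrepr, map_prod, inner_conj_symm, ← Finset.prod_mul_distrib]
  rw [Finset.prod_congr rfl fun i _ =>
      ((stdOrthonormalBasis ℂ V).sum_inner_mul_inner (x i) (y i)).symm,
    Finset.prod_univ_sum, Fintype.piFinset_univ]

/-- The orthogonal projection `Π_k` of `V^{⊗k}` onto its subspace of `G`-invariants. -/
def invariantProj {G : Type*} [Group G] (φ : Representation ℂ G V) (k : ℕ) :
    TensorPow V k →L[ℂ] TensorPow V k :=
  (rep φ k).invariants.starProjection

end Hermitian

end TensorPow

end

/-! Upper bound. Matrix coefficients of the tensor powers are regular functions on `G`, so an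
identity that holds on `K` spreads to `G` by Zariski density. Hence `Π_k` takes the same value on
the tensor powers of `v` and of `φ g v`, and by continuity on those of every point of the orbit
closure (`invariantProj_pure_eq_of_mem_closure`). So `v` may be replaced by a point `w` of least
norm in the closure; since `Π_k` is a contraction, the limsup is at most `‖w‖`.

Lower bound. `Π_m` is the average over `K`, so `‖Π_m w^{⊗m}‖²` is the moment `∫ ⟪w, k w⟫ ^ m` over
`K` (`integral_inner_pow_eq`). If the limsup were below `‖w‖`, these moments would be `O(B ^ m)`
with `B < ‖w‖²`, and the Laplace integral `∫ exp (t ⟪w, k w⟫)` would be `O(exp (t B))`. Laplace's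
method contradicts this: for large `t` the integral is at least `exp (t ‖w‖²)` times a negative
power of `t` (`not_norm_integral_inner_pow_le`). Summing over all `m` avoids any statement about
single moments, many of which may vanish.

The danger in Laplace's method is oscillation. With `D = ‖k w - w‖`, unitarity gives the integrand
modulus `exp (t ‖w‖² - t D² / 2)`, so the relevant scale is `D ~ t ^ (-1/2)`, and the phase `t Im
⟪w, k w⟫` must be small there. For `k = exp A` the linear term of the phase vanishes because `w` is
minimal (the moment map of Kempf and Ness), and the even terms vanish because `A` is skew. The phase
is thus `O(t D³)` (`exists_abs_im_inner_le`). Passing from exponentials to all `k` that move `w`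
little uses Lie theory of the closed group `K` and its compactness. -/

section

open Filter Topology

/-! ### Regular functions and Zariski density. -/

section Regular

variable {n : ℕ} {G : Subgroup (Matrix.GeneralLinearGroup (Fin n) ℂ)}

theorem IsRegularFun.const (c : ℂ) : IsRegularFun G (fun _ => c) :=
  ⟨MvPolynomial.C c, 0, fun g => by simp [evalGL]⟩

theorem GL_det_ne_zero (g : Matrix.GeneralLinearGroup (Fin n) ℂ) :
    (g : Matrix (Fin n) (Fin n) ℂ).det ≠ 0 :=
  (Matrix.isUnit_iff_isUnit_det _ |>.1 g.isUnit).ne_zero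

theorem evalGL_det (g : Matrix.GeneralLinearGroup (Fin n) ℂ) :
    evalGL (Matrix.mvPolynomialX (Fin n) (Fin n) ℂ).det g
      = (g : Matrix (Fin n) (Fin n) ℂ).det := by
  rw [evalGL, RingHom.map_det, Matrix.mvPolynomialX_mapMatrix_eval]

theorem IsRegularFun.add {f f' : G → ℂ} (hf : IsRegularFun G f) (hf' : IsRegularFun G f') :
    IsRegularFun G (fun g => f g + f' g) := by
  obtain ⟨p, m, h⟩ := hf
  obtain ⟨p', m', h'⟩ := hf'
  refine ⟨p * (Matrix.mvPolynomialX (Fin n) (Fin n) ℂ).det ^ m'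
    + p' * (Matrix.mvPolynomialX (Fin n) (Fin n) ℂ).det ^ m, m + m', fun g => ?_⟩
  have hd := GL_det_ne_zero g.1
  have hdet := evalGL_det g.1
  simp only [evalGL] at hdet
  simp only [h, h', evalGL, map_add, map_mul, map_pow, hdet]
  field_simp
  ring

theorem IsRegularFun.mul {f f' : G → ℂ} (hf : IsRegularFun G f) (hf' : IsRegularFun G f') :
    IsRegularFun G (fun g => f g * f' g) := by
  obtain ⟨p, m, h⟩ := hf
  obtain ⟨p', m', h'⟩ := hf'
  refine ⟨p * p', m + m', fun g => ?_⟩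
  have hd := GL_det_ne_zero g.1
  simp only [h, h', evalGL, map_mul]
  field_simp
  ring

theorem IsRegularFun.prod {ι : Type*} (s : Finset ι) {f : ι → G → ℂ}
    (hf : ∀ i, IsRegularFun G (f i)) : IsRegularFun G (fun g => ∏ i ∈ s, f i g) := by
  classical
  induction s using Finset.induction_on with
  | empty => simpa using IsRegularFun.const 1
  | insert a s ha ih =>
    simp only [Finset.prod_insert ha]
    exact (hf a).mul ih

/-- A regular function on `G` that is constant on the Zariski-dense subgroup `K` is constant. -/
theorem IsRegularFun.eq_const {K : Subgroup (Matrix.GeneralLinearGroup (Fin n) ℂ)}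
    (hG : IsComplexification K G) {f : G → ℂ} (hf : IsRegularFun G f) {c : ℂ}
    (h : ∀ g : G, g.1 ∈ K → f g = c) (g : G) : f g = c := by
  obtain ⟨p, m, hp⟩ := hf.add (IsRegularFun.const (-c))
  have hpG : evalGL p g.1 = 0 := by
    refine hG.zariskiDense p (fun k hk => ?_) g.1 g.2
    have h1 := hp ⟨k, hG.le hk⟩
    simp only [h ⟨k, hG.le hk⟩ hk, add_neg_cancel] at h1
    exact (div_eq_zero_iff.1 h1.symm).resolve_right (pow_ne_zero _ (GL_det_ne_zero k))
  have h1 := hp g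
  simp only [hpG, zero_div] at h1
  linear_combination h1

end Regular

/-! ### Invariant tensors and the projection along orbits. -/

namespace TensorPow

theorem span_range_pure (V : Type*) [AddCommGroup V] [Module ℂ V] (k : ℕ) :
    Submodule.span ℂ (Set.range (pure : (Fin k → V) → TensorPow V k)) = ⊤ :=
  PiTensorProduct.span_tprod_eq_top

variable {V : Type*} [NormedAddCommGroup V] [InnerProductSpace ℂ V] [FiniteDimensional ℂ V] {k : ℕ}

theorem continuous_pure : Continuous (pure : (Fin k → V) → TensorPow V k) := by
  have h : ∀ x : Fin k → V, pure x = ∑ p, (basis V k).repr (pure x) p • basis V k p := fun x =>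
    ((basis V k).sum_repr (pure x)).symm
  have hrepr : ∀ (z : Fin k → V) (p : Fin k → Fin (Module.finrank ℂ V)),
      (basis V k).repr (pure z) p = ∏ i, inner ℂ (stdOrthonormalBasis ℂ V (p i)) (z i) := by
    intro z p
    refine (Basis.piTensorProduct_repr_tprod_apply
      (fun _ : Fin k => (stdOrthonormalBasis ℂ V).toBasis) z p).trans ?_
    simp [OrthonormalBasis.repr_apply_apply]
  rw [funext h]
  simp only [hrepr]
  fun_prop

theorem norm_pure (v : V) : ‖(pure fun _ : Fin k => v)‖ = ‖v‖ ^ k := by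
  have h := inner_pure (fun _ : Fin k => v) (fun _ => v)
  rw [inner_self_eq_norm_sq_to_K, Finset.prod_const, Finset.card_univ, Fintype.card_fin,
    inner_self_eq_norm_sq_to_K] at h
  have h2 : ‖(pure fun _ : Fin k => v)‖ ^ 2 = (‖v‖ ^ k) ^ 2 := by
    rw [← pow_mul, mul_comm, pow_mul]
    exact_mod_cast h
  exact (pow_left_inj₀ (norm_nonneg _) (by positivity) two_ne_zero).1 h2

theorem inner_rep_rep {Γ : Type*} [Group Γ] {φ : Representation ℂ Γ V} {g : Γ}
    (h : ∀ x y : V, inner ℂ (φ g x) (φ g y) = inner ℂ x y) (x y : TensorPow V k) :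
    inner ℂ (rep φ k g x) (rep φ k g y) = inner ℂ x y := by
  have hx : x ∈ Submodule.span ℂ (Set.range (pure : (Fin k → V) → TensorPow V k)) := by
    rw [span_range_pure]; trivial
  have hy : y ∈ Submodule.span ℂ (Set.range (pure : (Fin k → V) → TensorPow V k)) := by
    rw [span_range_pure]; trivial
  induction hx using Submodule.span_induction with
  | zero => simp
  | add a b _ _ ha hb => rw [map_add, inner_add_left, inner_add_left, ha, hb]
  | smul c a _ ha => rw [map_smul, inner_smul_left, inner_smul_left, ha]
  | mem a ha =>
    obtain ⟨a, rfl⟩ := ha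
    induction hy using Submodule.span_induction with
    | zero => simp
    | add b c _ _ hb hc => rw [map_add, inner_add_right, inner_add_right, hb, hc]
    | smul c b _ hb => rw [map_smul, inner_smul_right, inner_smul_right, hb]
    | mem b hb =>
      obtain ⟨b, rfl⟩ := hb
      rw [rep_pure, rep_pure, inner_pure, inner_pure]
      exact Finset.prod_congr rfl fun i _ => h _ _

section Group

variable {n : ℕ} {K G : Subgroup (Matrix.GeneralLinearGroup (Fin n) ℂ)} {φ : Representation ℂ G V}

omit [FiniteDimensional ℂ V] in
theorem isRegularFun_inner (hφ : IsRationalRep φ) (x y : V) :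
    IsRegularFun G (fun g => inner ℂ x (φ g y)) :=
  hφ (innerSL ℂ x).toLinearMap y

theorem isRegularFun_inner_rep (hφ : IsRationalRep φ) (x y : TensorPow V k) :
    IsRegularFun G (fun g => inner ℂ x (rep φ k g y)) := by
  have hx : x ∈ Submodule.span ℂ (Set.range (pure : (Fin k → V) → TensorPow V k)) := by
    rw [span_range_pure]; trivial
  have hy : y ∈ Submodule.span ℂ (Set.range (pure : (Fin k → V) → TensorPow V k)) := by
    rw [span_range_pure]; trivial
  induction hx using Submodule.span_induction with
  | zero => simpa using IsRegularFun.const 0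
  | add a b _ _ ha hb => simpa only [inner_add_left] using ha.add hb
  | smul c a _ ha => simpa only [inner_smul_left] using (IsRegularFun.const _).mul ha
  | mem a ha =>
    obtain ⟨a, rfl⟩ := ha
    induction hy using Submodule.span_induction with
    | zero => simpa using IsRegularFun.const 0
    | add b c _ _ hb hc => simpa only [map_add, inner_add_right] using hb.add hc
    | smul c b _ hb => simpa only [map_smul, inner_smul_right] using (IsRegularFun.const _).mul hb
    | mem b hb =>
      obtain ⟨b, rfl⟩ := hb
      simp only [rep_pure, inner_pure]
      exact IsRegularFun.prod _ fun i => isRegularFun_inner hφ _ _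

variable (hG : IsComplexification K G) (hφ : IsRationalRep φ)
  (hinv : ∀ g : G, g.1 ∈ K → ∀ x y : V, inner ℂ (φ g x) (φ g y) = inner ℂ x y)

include hG hφ in
-- The unitarian trick: each coefficient `g ↦ ⟪y, g x⟫` is regular and constant on `K`, hence
-- constant on `G`.
theorem mem_invariants_of_forall_mem {x : TensorPow V k}
    (hx : ∀ g : G, g.1 ∈ K → rep φ k g x = x) : x ∈ (rep φ k).invariants := by
  rw [Representation.mem_invariants]
  intro g
  refine ext_inner_left ℂ fun y => ?_
  refine (isRegularFun_inner_rep hφ y x).eq_const hG (fun k hk => ?_) g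
  rw [hx k hk]

include hG hφ hinv in
-- `G` need not act unitarily, but this pairing is regular in `g` and constant on `K`, where the
-- action is unitary and fixes `x`.
theorem inner_rep_of_mem_invariants {x : TensorPow V k} (hx : x ∈ (rep φ k).invariants)
    (y : TensorPow V k) (g : G) : inner ℂ x (rep φ k g y) = inner ℂ x y := by
  refine (isRegularFun_inner_rep hφ x y).eq_const hG (fun k' hk => ?_) g
  rw [Representation.mem_invariants] at hx
  conv_lhs => rw [← hx k']
  exact inner_rep_rep (hinv k' hk) x y

include hG hφ hinv in
theorem invariantProj_rep (y : TensorPow V k) (g : G) :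
    invariantProj φ k (rep φ k g y) = invariantProj φ k y := by
  rw [← sub_eq_zero, ← map_sub]
  refine (Submodule.starProjection_apply_eq_zero_iff _).2 ?_
  rw [Submodule.mem_orthogonal]
  intro u hu
  rw [inner_sub_right, inner_rep_of_mem_invariants hG hφ hinv hu, sub_self]

include hG hφ hinv in
theorem invariantProj_pure_apply (v : V) (g : G) :
    invariantProj φ k (pure fun _ => φ g v) = invariantProj φ k (pure fun _ => v) := by
  rw [← rep_pure]
  exact invariantProj_rep hG hφ hinv _ g

include hG hφ hinv in
theorem invariantProj_pure_eq_of_mem_closure {v w : V}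
    (hw : w ∈ closure (Set.range fun g : G => φ g v)) :
    invariantProj φ k (pure fun _ => w) = invariantProj φ k (pure fun _ => v) := by
  have hc : Continuous fun x : V => invariantProj φ k (pure fun _ => x) :=
    (invariantProj φ k).continuous.comp (continuous_pure.comp (by fun_prop))
  have hcl : IsClosed {x : V | invariantProj φ k (pure fun _ => x)
      = invariantProj φ k (pure fun _ => v)} := isClosed_eq hc continuous_const
  refine closure_minimal ?_ hcl hw
  rintro _ ⟨g, rfl⟩
  exact invariantProj_pure_apply hG hφ hinv v g

theorem norm_invariantProj_pure_le (v : V) :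
    ‖invariantProj φ k (pure fun _ => v)‖ ≤ ‖v‖ ^ k := by
  rw [← norm_pure]
  exact Submodule.norm_starProjection_apply_le _ _

end Group

end TensorPow

end

section

open Filter Topology NormedSpace

/-! ### Lie algebras of closed groups in Banach algebras. -/

section LieAlgebra

variable {𝔸 : Type*} [NormedRing 𝔸] [NormedAlgebra ℝ 𝔸] [CompleteSpace 𝔸]

theorem exists_log_near_one (𝔸 : Type*) [NormedRing 𝔸] [NormedAlgebra ℝ 𝔸] [CompleteSpace 𝔸] :
    ∃ ℓ : 𝔸 → 𝔸, HasFDerivAt ℓ (ContinuousLinearMap.id ℝ 𝔸) 1 ∧ ℓ 1 = 0 ∧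
      ∀ᶠ x in 𝓝 (1 : 𝔸), exp (ℓ x) = x := by
  have h : HasStrictFDerivAt (exp : 𝔸 → 𝔸)
      ((ContinuousLinearEquiv.refl ℝ 𝔸 : 𝔸 ≃L[ℝ] 𝔸) : 𝔸 →L[ℝ] 𝔸) 0 :=
    hasStrictFDerivAt_exp_zero
  refine ⟨h.localInverse exp _ 0, ?_, ?_, ?_⟩
  · have := h.to_localInverse.hasFDerivAt
    rw [exp_zero] at this
    exact this
  · have := h.localInverse_apply_image
    rwa [exp_zero] at this
  · have := h.eventually_right_inverse
    rwa [exp_zero] at this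

theorem exp_nsmul_real (m : ℕ) (x : 𝔸) : exp (m • x) = exp x ^ m := by
  let _ : NormedAlgebra ℚ 𝔸 := NormedAlgebra.restrictScalars ℚ ℝ 𝔸
  exact exp_nsmul m x

theorem continuous_exp_real : Continuous (exp : 𝔸 → 𝔸) := by
  let _ : NormedAlgebra ℚ 𝔸 := NormedAlgebra.restrictScalars ℚ ℝ 𝔸
  exact exp_continuous

theorem exp_mul_exp_neg_real (x : 𝔸) : exp x * exp (-x) = 1 := by
  let _ : NormedAlgebra ℚ 𝔸 := NormedAlgebra.restrictScalars ℚ ℝ 𝔸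
  rw [← exp_add_of_commute (Commute.neg_right (Commute.refl x)), add_neg_cancel, exp_zero]

/-- If elements `x j` of a closed monoid satisfy `c j • (x j - 1) → Y` with `c j → ∞`, then `Y`
generates a one-parameter semigroup inside the monoid. -/
theorem exp_smul_mem_of_tendsto {L : Submonoid 𝔸} (hL : IsClosed (L : Set 𝔸)) {Y : 𝔸}
    {x : ℕ → 𝔸} {c : ℕ → ℝ} (hx : ∀ j, x j ∈ L) (hc : Tendsto c atTop atTop)
    (h : Tendsto (fun j => c j • (x j - 1)) atTop (𝓝 Y)) {t : ℝ} (ht : 0 ≤ t) :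
    exp (t • Y) ∈ L := by
  obtain ⟨ℓ, hℓ, hℓ1, hexp⟩ := exists_log_near_one 𝔸
  have hx1 : Tendsto x atTop (𝓝 1) := by
    have h1 := (tendsto_inv_atTop_zero.comp hc).smul h
    rw [zero_smul] at h1
    have h2 : Tendsto (fun j => x j - 1) atTop (𝓝 0) := by
      refine h1.congr' ?_
      filter_upwards [hc.eventually_gt_atTop 0] with j hj
      simp [smul_smul, inv_mul_cancel₀ hj.ne']
    simpa using h2.add_const 1
  have hlog : Tendsto (fun j => c j • ℓ (x j)) atTop (𝓝 Y) := by
    have ho := hℓ.isLittleO.comp_tendsto hx1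
    simp only [hℓ1, Function.comp_def, sub_zero] at ho
    have h3 : (fun j => c j • (ℓ (x j) - (x j - 1))) =o[atTop] fun j => c j • (x j - 1) := by
      exact (Asymptotics.isBigO_refl c atTop).smul_isLittleO ho
    have h4 : Tendsto (fun j => c j • (ℓ (x j) - (x j - 1))) atTop (𝓝 0) := by
      have := h3.trans_isBigO (h.isBigO_one ℝ)
      exact (Asymptotics.isLittleO_one_iff ℝ).1 this
    have := h4.add h
    rw [zero_add] at this
    refine this.congr fun j => ?_
    rw [← smul_add, sub_add_cancel]
  -- The power `⌊t c_j⌋` of `x j` has logarithm about `t c_j ℓ (x j)`, which tends to `t Y`.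
  have hfl : Tendsto (fun j => ((⌊t * c j⌋₊ : ℝ) / c j) • (c j • ℓ (x j))) atTop (𝓝 (t • Y)) :=
    ((tendsto_nat_floor_mul_div_atTop ht).comp hc).smul hlog
  have hfin : Tendsto (fun j => x j ^ ⌊t * c j⌋₊) atTop (𝓝 (exp (t • Y))) := by
    refine ((continuous_exp_real.tendsto _).comp hfl).congr' ?_
    filter_upwards [hc.eventually_gt_atTop 0, hx1.eventually hexp] with j hj hj2
    have : ((⌊t * c j⌋₊ : ℝ) / c j) • (c j • ℓ (x j)) = ⌊t * c j⌋₊ • ℓ (x j) := by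
      rw [smul_smul, div_mul_cancel₀ _ hj.ne', Nat.cast_smul_eq_nsmul]
    rw [Function.comp_apply, this, exp_nsmul_real, hj2]
  exact hL.mem_of_tendsto hfin (Eventually.of_forall fun j => L.pow_mem (hx j) _)

theorem tendsto_smul_exp_mul_exp_sub_one (X Y : 𝔸) :
    Tendsto (fun j : ℕ => (j : ℝ) • (exp ((j : ℝ)⁻¹ • X) * exp ((j : ℝ)⁻¹ • Y) - 1)) atTop
      (𝓝 (X + Y)) := by
  have hX : HasDerivAt (fun t : ℝ => exp (t • X)) X 0 := by
    simpa using hasDerivAt_exp_smul_const (𝕂 := ℝ) X (0 : ℝ)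
  have hY : HasDerivAt (fun t : ℝ => exp (t • Y)) Y 0 := by
    simpa using hasDerivAt_exp_smul_const (𝕂 := ℝ) Y (0 : ℝ)
  have h := (hX.mul hY).hasFDerivAt.lim (1 : ℝ) (α := ℕ) (c := fun j : ℕ => (j : ℝ)) (l := atTop)
    (by simpa only [RCLike.norm_natCast] using tendsto_natCast_atTop_atTop (R := ℝ))
  simpa using h

/-- The Lie algebra of a closed submonoid of a Banach algebra. -/
def lieAlgebraOf (L : Submonoid 𝔸) (hL : IsClosed (L : Set 𝔸)) : Submodule ℝ 𝔸 where
  carrier := {X | ∀ t : ℝ, exp (t • X) ∈ L}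
  zero_mem' t := by simp
  smul_mem' s X hX t := by rw [smul_smul]; exact hX _
  add_mem' {X Y} hX hY t := by
    -- Natural powers reach only `t ≥ 0`; negative times follow from `-X` and `-Y`.
    have key : ∀ X Y : 𝔸, (∀ t : ℝ, exp (t • X) ∈ L) → (∀ t : ℝ, exp (t • Y) ∈ L) →
        ∀ t : ℝ, 0 ≤ t → exp (t • (X + Y)) ∈ L := fun X Y hX hY t ht =>
      exp_smul_mem_of_tendsto hL (fun j => L.mul_mem (hX _) (hY _))
        tendsto_natCast_atTop_atTop (tendsto_smul_exp_mul_exp_sub_one X Y) ht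
    rcases le_total 0 t with ht | ht
    · exact key X Y hX hY t ht
    · have := key (-X) (-Y) (fun s => by simpa using hX (-s)) (fun s => by simpa using hY (-s)) (-t)
        (by linarith)
      rw [← neg_add, smul_neg, neg_smul, neg_neg] at this
      exact this

variable [FiniteDimensional ℝ 𝔸]

/-- A linear subspace meeting the Lie algebra trivially contains no small nonzero logarithms of
elements of the group. -/
theorem eventually_eq_zero_of_exp_mem {L : Submonoid 𝔸} (hL : IsClosed (L : Set 𝔸))
    (hinv : ∀ x ∈ L, ∀ y, x * y = 1 → y ∈ L) (C : Submodule ℝ 𝔸)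
    (hC : ∀ X ∈ C, X ∈ lieAlgebraOf L hL → X = 0) :
    ∀ᶠ X in 𝓝 (0 : 𝔸), X ∈ C → exp X ∈ L → X = 0 := by
  by_contra hcon
  have hfr : ∃ᶠ X in 𝓝 (0 : 𝔸), X ∈ C ∧ exp X ∈ L ∧ X ≠ 0 := by
    rw [Filter.Frequently]
    refine fun h => hcon (h.mono fun X hX h1 h2 => ?_)
    by_contra h3
    exact hX ⟨h1, h2, h3⟩
  obtain ⟨X, hX0, hX⟩ := Filter.exists_seq_forall_of_frequently hfr
  have hnorm : ∀ j, ‖(‖X j‖)⁻¹ • X j‖ = 1 := fun j => by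
    rw [norm_smul, norm_inv, norm_norm, inv_mul_cancel₀ (norm_ne_zero_iff.2 (hX j).2.2)]
  have : ProperSpace 𝔸 := FiniteDimensional.proper ℝ 𝔸
  -- A limit direction `Y` of the small logarithms is a unit vector that lies both in `C` and in the
  -- Lie algebra, which is impossible.
  obtain ⟨Y, hY, σ, hσ, hlim⟩ := (isCompact_sphere (0 : 𝔸) 1).tendsto_subseq
    (x := fun j => (‖X j‖)⁻¹ • X j) (fun j => by simpa using hnorm j)
  have hXσ : Tendsto (X ∘ σ) atTop (𝓝 0) := hX0.comp hσ.tendsto_atTop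
  have hc : Tendsto (fun j => (‖X (σ j)‖)⁻¹) atTop atTop := by
    refine tendsto_inv_nhdsGT_zero.comp ?_
    refine tendsto_nhdsWithin_iff.2 ⟨?_, Eventually.of_forall fun j => norm_pos_iff.2 (hX _).2.2⟩
    simpa using hXσ.norm
  -- The case `s = -1` concerns the inverses `exp (-X j)` and gives the one-parameter group at
  -- negative times.
  have key : ∀ s : ℝ, (s = 1 ∨ s = -1) →
      Tendsto (fun j => (‖X (σ j)‖)⁻¹ • (exp (s • X (σ j)) - 1)) atTop (𝓝 (s • Y)) := by
    intro s hs
    have hsX : Tendsto (fun j => s • X (σ j)) atTop (𝓝 0) := by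
      simpa using hXσ.const_smul s
    have ho := (hasFDerivAt_exp_zero (𝕂 := ℝ) (𝔸 := 𝔸)).isLittleO.comp_tendsto hsX
    simp only [Function.comp_def, exp_zero, sub_zero, one_apply_eq_self] at ho
    have h3 := (Asymptotics.isBigO_refl (fun j => (‖X (σ j)‖)⁻¹) atTop).smul_isLittleO ho
    have h5 : Tendsto (fun j => (‖X (σ j)‖)⁻¹ • (s • X (σ j))) atTop (𝓝 (s • Y)) := by
      refine (hlim.const_smul s).congr fun j => ?_
      simp only [Function.comp_def]
      rw [smul_comm]
    have h4 := (Asymptotics.isLittleO_one_iff ℝ).1 (h3.trans_isBigO (h5.isBigO_one ℝ))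
    have := h4.add h5
    rw [zero_add] at this
    refine this.congr fun j => ?_
    rw [← smul_add, sub_add_cancel]
  have hYL : Y ∈ lieAlgebraOf L hL := by
    intro t
    rcases le_total 0 t with ht | ht
    · have h1 := key 1 (Or.inl rfl)
      simp only [one_smul] at h1
      exact exp_smul_mem_of_tendsto hL (fun j => (hX (σ j)).2.1) hc h1 ht
    · have h1 := key (-1) (Or.inr rfl)
      simp only [neg_smul, one_smul] at h1
      have := exp_smul_mem_of_tendsto hL (fun j => hinv _ (hX (σ j)).2.1 _
        (exp_mul_exp_neg_real _)) hc h1 (t := -t) (by linarith)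
      simpa using this
  have hYC : Y ∈ C := by
    refine (Submodule.closed_of_finiteDimensional C).mem_of_tendsto hlim
      (Eventually.of_forall fun j => C.smul_mem _ (hX _).1)
  have := hC Y hYC hYL
  rw [this] at hY
  simp at hY

omit [FiniteDimensional ℝ 𝔸] in
/-- Every element near `1` is of the form `exp (P₁ Z) * exp (P₂ Z) * exp (P₃ Z)` with `Z` small,
when `P₁ + P₂ + P₃ = 1`. -/
theorem map_nhds_exp_mul_exp_mul_exp (P₁ P₂ P₃ : 𝔸 →L[ℝ] 𝔸)
    (hP : P₁ + P₂ + P₃ = ContinuousLinearMap.id ℝ 𝔸) :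
    map (fun Z => exp (P₁ Z) * exp (P₂ Z) * exp (P₃ Z)) (𝓝 0) = 𝓝 1 := by
  have h (P : 𝔸 →L[ℝ] 𝔸) : HasStrictFDerivAt (fun Z => exp (P Z)) P 0 := by
    have h1 : HasStrictFDerivAt (exp : 𝔸 → 𝔸) (1 : 𝔸 →L[ℝ] 𝔸) (P 0) := by
      rw [map_zero]; exact hasStrictFDerivAt_exp_zero
    exact h1.comp 0 P.hasStrictFDerivAt
  have hd : HasStrictFDerivAt (fun Z => exp (P₁ Z) * exp (P₂ Z) * exp (P₃ Z))
      ((ContinuousLinearEquiv.refl ℝ 𝔸 : 𝔸 ≃L[ℝ] 𝔸) : 𝔸 →L[ℝ] 𝔸) 0 := by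
    refine (((h P₁).mul' (h P₂)).mul' (h P₃)).congr_fderiv ?_
    ext Z
    have := congrArg (fun f : 𝔸 →L[ℝ] 𝔸 => f Z) hP
    simp only [add_apply, ContinuousLinearMap.id_apply] at this
    simp
    refine Eq.trans ?_ this
    abel
  have := hd.map_nhds_eq_of_equiv
  simpa using this

/-- Near `1`, a closed group is the product of the exponential of a complement of an isotropy
algebra and the exponential of the isotropy algebra. -/
theorem eventually_exists_exp_mul_exp {W : Type*} [NormedAddCommGroup W] [NormedSpace ℝ W]
    {L : Submonoid 𝔸} (hL : IsClosed (L : Set 𝔸))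
    (hinv : ∀ x ∈ L, ∀ y, x * y = 1 → y ∈ L) (ev : 𝔸 →ₗ[ℝ] W) :
    ∃ C : ℝ, 0 < C ∧ ∀ η > 0, ∀ᶠ g in 𝓝 (1 : 𝔸), g ∈ L →
      ∃ X ∈ lieAlgebraOf L hL, ∃ S ∈ lieAlgebraOf L hL,
        ev S = 0 ∧ g = exp X * exp S ∧ ‖X‖ ≤ C * ‖ev X‖ ∧ ‖X‖ < η := by
  set 𝔩 := lieAlgebraOf L hL with h𝔩
  set 𝔰 : Submodule ℝ 𝔸 := 𝔩 ⊓ LinearMap.ker ev with h𝔰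
  obtain ⟨Q, hQ⟩ := LinearMap.exists_leftInverse_of_injective 𝔩.subtype (by simp)
  obtain ⟨R, hR⟩ := LinearMap.exists_leftInverse_of_injective 𝔰.subtype (by simp)
  have hQ' : ∀ X (hX : X ∈ 𝔩), Q X = ⟨X, hX⟩ := fun X hX => LinearMap.congr_fun hQ ⟨X, hX⟩
  have hR' : ∀ X (hX : X ∈ 𝔰), R X = ⟨X, hX⟩ := fun X hX => LinearMap.congr_fun hR ⟨X, hX⟩
  set q : 𝔸 →ₗ[ℝ] 𝔸 := 𝔩.subtype ∘ₗ Q with hq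
  set r : 𝔸 →ₗ[ℝ] 𝔸 := 𝔰.subtype ∘ₗ R with hr
  have hqm : ∀ X, q X ∈ 𝔩 := fun X => (Q X).2
  have hrm : ∀ X, r X ∈ 𝔰 := fun X => (R X).2
  have hqi : ∀ X ∈ 𝔩, q X = X := fun X hX => by simp [hq, hQ' X hX]
  have hri : ∀ X ∈ 𝔰, r X = X := fun X hX => by simp [hr, hR' X hX]
  -- The three maps project onto a complement `𝔪` of the isotropy algebra in `𝔩`, onto the isotropy
  -- algebra `𝔰`, and onto a complement of `𝔩`.
  set P₁ : 𝔸 →L[ℝ] 𝔸 := LinearMap.toContinuousLinearMap (q - r ∘ₗ q) with hP₁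
  set P₂ : 𝔸 →L[ℝ] 𝔸 := LinearMap.toContinuousLinearMap (r ∘ₗ q) with hP₂
  set P₃ : 𝔸 →L[ℝ] 𝔸 := LinearMap.toContinuousLinearMap (LinearMap.id - q) with hP₃
  have hP : P₁ + P₂ + P₃ = ContinuousLinearMap.id ℝ 𝔸 := by
    ext Z; simp [hP₁, hP₂, hP₃]
  have hmap := map_nhds_exp_mul_exp_mul_exp P₁ P₂ P₃ hP
  have hker := eventually_eq_zero_of_exp_mem hL hinv (LinearMap.ker q)
    (fun X hX hXL => by rw [← hqi X hXL]; exact hX)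
  have hP₃t : Tendsto P₃ (𝓝 0) (𝓝 0) := by simpa using P₃.continuous.tendsto 0
  have hP₁t : Tendsto (fun Z => ‖P₁ Z‖) (𝓝 0) (𝓝 0) := by
    simpa using (P₁.continuous.tendsto 0).norm
  set 𝔪 : Submodule ℝ 𝔸 := 𝔩 ⊓ LinearMap.ker r with h𝔪
  -- `ev` is injective on `𝔪`, and in finite dimension this bounds `X` by `ev X`.
  obtain ⟨C, hC, hanti⟩ := LinearMap.exists_antilipschitzWith (ev ∘ₗ 𝔪.subtype) (by
    rw [LinearMap.ker_eq_bot']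
    rintro ⟨X, hX⟩ h0
    have hXs : X ∈ 𝔰 := ⟨hX.1, h0⟩
    have : X = 0 := by rw [← hri X hXs]; exact hX.2
    simpa using this)
  refine ⟨C, hC, fun η hη => ?_⟩
  rw [← hmap, eventually_map]
  filter_upwards [hP₃t.eventually hker, hP₁t.eventually (gt_mem_nhds hη)] with Z hZ hZη hg
  have h1 : P₁ Z ∈ 𝔩 := 𝔩.sub_mem (hqm _) (hrm _).1
  have h2 : P₂ Z ∈ 𝔰 := hrm _
  -- The other two factors lie in `L`, so the third does too; being transverse to `𝔩` and small, `P₃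
  -- Z` must vanish.
  have h3 : exp (P₃ Z) ∈ L := by
    have e1 : exp (P₁ Z) ∈ L := by simpa using h1 1
    have e2 : exp (P₂ Z) ∈ L := by simpa using h2.1 1
    have i1 := hinv _ e1 _ (exp_mul_exp_neg_real _)
    have i2 := hinv _ e2 _ (exp_mul_exp_neg_real _)
    have : exp (P₃ Z) = exp (-P₂ Z) * (exp (-P₁ Z) * (exp (P₁ Z) * exp (P₂ Z) * exp (P₃ Z))) := by
      have a1 := exp_mul_exp_neg_real (-P₁ Z)
      have a2 := exp_mul_exp_neg_real (-P₂ Z)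
      rw [neg_neg] at a1 a2
      calc exp (P₃ Z) = exp (-P₂ Z) * ((exp (-P₁ Z) * exp (P₁ Z)) * exp (P₂ Z)) * exp (P₃ Z) := by
            rw [a1, one_mul, a2, one_mul]
        _ = _ := by simp only [mul_assoc]
    rw [this]
    exact L.mul_mem i2 (L.mul_mem i1 hg)
  have h30 : P₃ Z = 0 := hZ (by simp [hP₃, hqi _ (hqm Z)]) h3
  have hm : P₁ Z ∈ 𝔪 := ⟨h1, by simp [hP₁, hri _ (hrm (q Z))]⟩
  refine ⟨P₁ Z, h1, P₂ Z, h2.1, h2.2, by rw [h30, exp_zero, mul_one], ?_, hZη⟩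
  have := hanti.le_mul_dist ⟨P₁ Z, hm⟩ 0
  simpa using this

end LieAlgebra

end

section

open Filter Topology NormedSpace
open scoped Matrix.Norms.Operator

/-! ### Complex one-parameter groups and the moment map. -/

section Holomorphic

theorem Differentiable.eq_of_forall_ofReal_eq {f g : ℂ → ℂ} (hf : Differentiable ℂ f)
    (hg : Differentiable ℂ g) (h : ∀ t : ℝ, f t = g t) : f = g := by
  have hf' : AnalyticOnNhd ℂ f Set.univ :=
    hf.differentiableOn.analyticOnNhd isOpen_univ
  have hg' : AnalyticOnNhd ℂ g Set.univ :=
    hg.differentiableOn.analyticOnNhd isOpen_univ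
  refine hf'.eq_of_frequently_eq (z₀ := 0) hg' ?_
  have ht : Tendsto (fun t : ℝ => (t : ℂ)) (𝓝[≠] 0) (𝓝[≠] 0) := by
    refine tendsto_nhdsWithin_iff.2 ⟨?_, ?_⟩
    · have := (Complex.continuous_ofReal.tendsto 0).mono_left (nhdsWithin_le_nhds (s := {0}ᶜ))
      simpa using this
    · filter_upwards [self_mem_nhdsWithin] with t ht
      simpa using ht
  exact ht.frequently (Eventually.of_forall h).frequently

theorem MvPolynomial.differentiable_eval {σ : Type*} [Finite σ] (p : MvPolynomial σ ℂ)
    {f : ℂ → σ → ℂ} (hf : ∀ i, Differentiable ℂ fun z => f z i) :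
    Differentiable ℂ fun z => MvPolynomial.eval (f z) p := by
  induction p using MvPolynomial.induction_on with
  | C a => simp
  | add p q hp hq => simp only [map_add]; exact hp.add hq
  | mul_X p i hp => simp only [map_mul, MvPolynomial.eval_X]; exact hp.mul (hf i)

theorem differentiable_exp_smul {𝔸 : Type*} [NormedRing 𝔸] [NormedAlgebra ℂ 𝔸] [CompleteSpace 𝔸]
    (X : 𝔸) : Differentiable ℂ fun z : ℂ => exp (z • X) := fun z =>
  (hasDerivAt_exp_smul_const (𝕂 := ℂ) X z).differentiableAt

end Holomorphic

section Complexification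

variable {n : ℕ} {G : Subgroup (Matrix.GeneralLinearGroup (Fin n) ℂ)}
  {V : Type*} [NormedAddCommGroup V] [InnerProductSpace ℂ V] [FiniteDimensional ℂ V]
  {φ : Representation ℂ G V}

/-- A real one-parameter subgroup of an algebraic group `G` extends to a complex one, and any
rational representation of `G` is compatible with the extension. -/
theorem exists_rep_eq_exp_smul (hG : IsLinearAlgebraic G) (hφ : IsRationalRep φ)
    {X : Matrix (Fin n) (Fin n) ℂ} {A : V →L[ℂ] V}
    (h : ∀ t : ℝ, ∃ g : G, (g.1 : Matrix (Fin n) (Fin n) ℂ) = exp (t • X) ∧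
      ∀ x, φ g x = exp (t • A) x) (z : ℂ) : ∃ g : G, ∀ x, φ g x = exp (z • A) x := by
  obtain ⟨I, hI⟩ := hG
  have hdX : ∀ ij : Fin n × Fin n, Differentiable ℂ fun z : ℂ => exp (z • X) ij.1 ij.2 := by
    intro ij
    have h1 := differentiable_exp_smul X
    let e : Matrix (Fin n) (Fin n) ℂ →ₗ[ℂ] ℂ :=
      { toFun := fun M => M ij.1 ij.2, map_add' := fun _ _ => rfl, map_smul' := fun _ _ => rfl }
    exact (LinearMap.toContinuousLinearMap e).differentiable.comp h1
  have hdp : ∀ p : MvPolynomial (Fin n × Fin n) ℂ, Differentiable ℂ fun z : ℂ =>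
      MvPolynomial.eval (fun ij : Fin n × Fin n => exp (z • X) ij.1 ij.2) p := fun p =>
    p.differentiable_eval hdX
  have hreal : ∀ t : ℝ, ((t : ℂ) • X) = t • X := fun t => by
    ext i j; simp
  have hrealA : ∀ t : ℝ, ((t : ℂ) • A) = t • A := fun t => by
    ext i; simp
  have hunit : ∀ z : ℂ, IsUnit (exp (z • X)) := fun z => Matrix.isUnit_exp _
  set γ : ℂ → Matrix.GeneralLinearGroup (Fin n) ℂ := fun z => (hunit z).unit with hγ
  have hγv : ∀ z, (γ z : Matrix (Fin n) (Fin n) ℂ) = exp (z • X) := fun z => rfl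
  have hγG : ∀ z, γ z ∈ G := by
    intro z
    rw [hI]
    intro p hp
    have := (hdp p).eq_of_forall_ofReal_eq (g := fun _ => 0) (by fun_prop) (fun t => by
      obtain ⟨g, hg, -⟩ := h t
      have := (hI g.1).1 g.2 p hp
      rw [evalGL, hg] at this
      rw [hreal t]
      exact this)
    exact congrFun this z
  refine ⟨⟨γ z, hγG z⟩, fun x => ?_⟩
  refine ext_inner_left ℂ fun y => ?_
  obtain ⟨p, m, hp⟩ := TensorPow.isRegularFun_inner hφ y x
  have hexp : Differentiable ℂ fun z : ℂ => inner ℂ y (exp (z • A) x) :=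
    (innerSL ℂ y).differentiable.comp
      (((ContinuousLinearMap.apply ℂ V x).differentiable).comp (differentiable_exp_smul A))
  have hdet : ∀ z : ℂ, (exp (z • X)).det =
      MvPolynomial.eval (fun ij : Fin n × Fin n => exp (z • X) ij.1 ij.2)
        (Matrix.mvPolynomialX (Fin n) (Fin n) ℂ).det := fun z => by
    rw [← hγv, ← evalGL_det]; rfl
  have hd : Differentiable ℂ fun z : ℂ => (exp (z • X)).det ^ m := by
    simp only [hdet]
    exact (hdp _).pow m
  -- Clearing the denominator `det ^ m` leaves two entire functions that agree on the real line.
  have key := (hexp.mul hd).eq_of_forall_ofReal_eq (hdp p) (fun t => by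
    obtain ⟨g, hg, hgA⟩ := h t
    have h1 := hp g
    simp only [evalGL, hg, hgA] at h1
    have h2 : (exp (t • X)).det ^ m ≠ 0 := by
      rw [← hg]; exact pow_ne_zero _ (GL_det_ne_zero _)
    simp only [Pi.mul_apply]
    rw [hreal, hrealA, h1, div_mul_cancel₀ _ h2])
  have h1 := hp ⟨γ z, hγG z⟩
  have h2 := congrFun key z
  simp only [Pi.mul_apply] at h2
  simp only [evalGL, hγv] at h1
  rw [h1, ← h2, mul_div_cancel_right₀]
  rw [← hγv]; exact pow_ne_zero _ (GL_det_ne_zero _)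

/-- The moment map vanishes at a vector of minimal norm along a complex one-parameter group. -/
theorem im_inner_apply_eq_zero {A : V →L[ℂ] V} {w : V}
    (h : ∀ z : ℂ, ‖w‖ ≤ ‖exp (z • A) w‖) : (inner ℂ w (A w)).im = 0 := by
  let _ : InnerProductSpace ℝ V := InnerProductSpace.rclikeToReal ℂ V
  have h1 : HasDerivAt (fun t : ℝ => exp (t • (Complex.I • A)) w) (Complex.I • A w) 0 := by
    have h0 := hasDerivAt_exp_smul_const (𝕂 := ℝ) (Complex.I • A) (0 : ℝ)
    have h2 := (((ContinuousLinearMap.apply ℂ V w).restrictScalars ℝ).hasFDerivAt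
      (x := exp ((0 : ℝ) • (Complex.I • A)))).comp_hasDerivAt (0 : ℝ) h0
    simpa [Function.comp_def] using h2
  have h2 := h1.norm_sq
  have hmin : IsLocalMin (fun t : ℝ => ‖exp (t • (Complex.I • A)) w‖ ^ 2) 0 := by
    refine Eventually.of_forall fun t => ?_
    -- Along the imaginary direction the squared norm has derivative `2 Re ⟪w, i A w⟫ = -2 Im ⟪w, A
    -- w⟫` at `0`.
    have h3 := h ((t : ℂ) * Complex.I)
    have h4 : ((t : ℂ) * Complex.I) • A = t • (Complex.I • A) := by
      ext x; simp [mul_smul]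
    rw [h4] at h3
    simp only [zero_smul, exp_zero, one_apply_eq_self]
    gcongr
  have h5 := hmin.hasDerivAt_eq_zero h2
  have h6 : inner ℝ w (Complex.I • A w) = 0 := by simpa using h5
  have h7 : (inner ℂ w (Complex.I • A w)).re = 0 := h6
  rw [inner_smul_right] at h7
  simpa using h7

/-- The even terms of the two exponential series cancel, so after the linear term the remainder is
cubic. -/
theorem exists_norm_exp_sub_exp_neg_le (𝔸 : Type*) [NormedRing 𝔸] [NormedAlgebra ℂ 𝔸]
    [CompleteSpace 𝔸] :
    ∃ C : ℝ, 0 < C ∧ ∀ᶠ A in 𝓝 (0 : 𝔸), ‖exp A - exp (-A) - (2 : ℂ) • A‖ ≤ C * ‖A‖ ^ 3 := by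
  have h := (exp_hasFPowerSeriesAt_zero (𝕂 := ℂ) (𝔸 := 𝔸)).isBigO_sub_partialSum_pow 3
  have hneg : Tendsto (fun A : 𝔸 => -A) (𝓝 0) (𝓝 0) := by simpa using (continuous_neg.tendsto (0 : 𝔸))
  have h2 := h.comp_tendsto hneg
  have h3 := (h.sub (h2.trans (Asymptotics.isBigO_of_le _ (fun A => by simp)) :
    _ =O[𝓝 0] fun A : 𝔸 => ‖A‖ ^ 3))
  obtain ⟨C, hC, hb⟩ := h3.exists_pos
  refine ⟨C, hC, ?_⟩
  filter_upwards [hb.bound] with A hA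
  simp only [zero_add, FormalMultilinearSeries.partialSum, Finset.sum_range_succ,
    Finset.sum_range_zero, expSeries_apply_eq, Function.comp_apply, norm_pow, norm_norm] at hA
  refine le_trans (le_of_eq ?_) hA
  congr 1
  simp only [even_two.neg_pow, pow_zero, pow_one, smul_neg, two_smul]
  simp
  abel

/-- By unitarity `⟪w, exp (-A) w⟫` is the conjugate of `⟪w, exp A w⟫`, so twice the imaginary part
is that of `⟪w, (exp A - exp (-A)) w⟫`. The linear term may be subtracted freely because of `h0`. -/
theorem abs_im_inner_exp_le {A : V →L[ℂ] V} {w : V}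
    (hA : ∀ x y, inner ℂ (exp A x) (exp A y) = inner ℂ x y) (h0 : (inner ℂ w (A w)).im = 0) :
    |(inner ℂ w (exp A w)).im| ≤ ‖w‖ ^ 2 * ‖exp A - exp (-A) - (2 : ℂ) • A‖ := by
  have h1 : inner ℂ w (exp (-A) w) = inner ℂ (exp A w) w := by
    rw [← hA w (exp (-A) w), ← mul_apply_eq_comp, exp_mul_exp_neg_real]
    rfl
  have h2 : (inner ℂ (exp A w) w).im = -(inner ℂ w (exp A w)).im := by
    rw [← inner_conj_symm, Complex.conj_im]
  have h3 : 2 * (inner ℂ w (exp A w)).im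
      = (inner ℂ w ((exp A - exp (-A) - (2 : ℂ) • A) w)).im := by
    simp only [sub_apply, smul_apply, inner_sub_right,
      Complex.sub_im, h1, h2, inner_smul_right, Complex.mul_im, h0]
    simp
    ring
  have h4 : |(inner ℂ w ((exp A - exp (-A) - (2 : ℂ) • A) w)).im|
      ≤ ‖w‖ ^ 2 * ‖exp A - exp (-A) - (2 : ℂ) • A‖ := by
    calc _ ≤ ‖inner ℂ w ((exp A - exp (-A) - (2 : ℂ) • A) w)‖ := Complex.abs_im_le_norm _
      _ ≤ ‖w‖ * ‖(exp A - exp (-A) - (2 : ℂ) • A) w‖ := norm_inner_le_norm _ _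
      _ ≤ ‖w‖ * (‖exp A - exp (-A) - (2 : ℂ) • A‖ * ‖w‖) := by
          gcongr; exact ContinuousLinearMap.le_opNorm _ _
      _ = _ := by ring
  rw [← h3, abs_mul, abs_two] at h4
  have := abs_nonneg (inner ℂ w (exp A w)).im
  linarith

end Complexification

end

section

open Filter Topology NormedSpace
open scoped Matrix.Norms.Operator

/-! ### Third-order phase estimate at a minimal vector. -/

section Graph

variable {n : ℕ} {K G : Subgroup (Matrix.GeneralLinearGroup (Fin n) ℂ)}
  {V : Type*} [NormedAddCommGroup V] [InnerProductSpace ℂ V] [FiniteDimensional ℂ V]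
  {φ : Representation ℂ G V}

theorem IsRegularFun.continuous {f : G → ℂ} (hf : IsRegularFun G f) : Continuous f := by
  obtain ⟨p, m, h⟩ := hf
  rw [funext h]
  have hv : Continuous fun g : G => (g.1 : Matrix (Fin n) (Fin n) ℂ) :=
    Units.continuous_val.comp continuous_subtype_val
  refine Continuous.div ?_ (hv.matrix_det.pow m) fun g => pow_ne_zero _ (GL_det_ne_zero _)
  refine p.continuous_eval.comp (continuous_pi fun ij => ?_)
  exact hv.matrix_elem ij.1 ij.2

theorem IsRationalRep.continuous_apply (hφ : IsRationalRep φ) (x : V) :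
    Continuous fun g : G => φ g x := by
  have h : ∀ g, φ g x = ∑ i, inner ℂ (stdOrthonormalBasis ℂ V i) (φ g x) •
      stdOrthonormalBasis ℂ V i := fun g => ((stdOrthonormalBasis ℂ V).sum_repr' (φ g x)).symm
  rw [funext h]
  exact continuous_finsetSum _ fun i _ =>
    (TensorPow.isRegularFun_inner hφ _ x).continuous.smul continuous_const

/-- The graph of a representation, in the algebra of pairs of a matrix and an endomorphism. -/
noncomputable def graphHom (φ : Representation ℂ G V) : G →* Matrix (Fin n) (Fin n) ℂ × (V →L[ℂ] V) where
  toFun g := ((g.1 : Matrix (Fin n) (Fin n) ℂ), LinearMap.toContinuousLinearMap (φ g))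
  map_one' := by
    ext <;> simp
  map_mul' g h := by
    ext <;> simp

theorem continuous_graphHom (hφ : IsRationalRep φ) : Continuous (graphHom φ) := by
  refine Continuous.prodMk (Units.continuous_val.comp continuous_subtype_val) ?_
  exact continuous_clm_apply.2 fun x => hφ.continuous_apply x

/-- The graph of a representation over a subgroup `K`. -/
noncomputable def graphOver (K : Subgroup (Matrix.GeneralLinearGroup (Fin n) ℂ)) (φ : Representation ℂ G V) :
    Submonoid (Matrix (Fin n) (Fin n) ℂ × (V →L[ℂ] V)) :=
  (K.subgroupOf G).toSubmonoid.map (graphHom φ)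

theorem isCompact_graphOver (hG : IsComplexification K G) (hφ : IsRationalRep φ) :
    IsCompact (graphOver K φ : Set (Matrix (Fin n) (Fin n) ℂ × (V →L[ℂ] V))) := by
  have h1 : IsCompact ((K.subgroupOf G : Subgroup G) : Set G) := by
    rw [Subtype.isCompact_iff]
    convert hG.isCompact
    ext g
    simp only [Set.mem_image, SetLike.mem_coe, Subgroup.mem_subgroupOf, Subtype.exists,
      exists_and_left, exists_prop, exists_eq_right_right]
    exact ⟨fun h => h.1, fun h => ⟨h, hG.le h⟩⟩
  exact h1.image (continuous_graphHom hφ)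

theorem inv_mem_graphOver {x : Matrix (Fin n) (Fin n) ℂ × (V →L[ℂ] V)} (hx : x ∈ graphOver K φ)
    {y : Matrix (Fin n) (Fin n) ℂ × (V →L[ℂ] V)} (h : x * y = 1) : y ∈ graphOver K φ := by
  obtain ⟨g, hg, rfl⟩ := hx
  refine ⟨g⁻¹, (K.subgroupOf G).inv_mem hg, ?_⟩
  calc graphHom φ g⁻¹ = graphHom φ g⁻¹ * (graphHom φ g * y) := by rw [h, mul_one]
    _ = y := by rw [← mul_assoc, ← map_mul, inv_mul_cancel, map_one, one_mul]

theorem exp_apply_eq_self {A : V →L[ℂ] V} {w : V} (h : A w = 0) : exp A w = w := by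
  have h1 := (exp_series_hasSum_exp' (𝕂 := ℂ) A)
  have h2 := (ContinuousLinearMap.apply ℂ V w).hasSum h1
  have h3 : HasSum (fun m : ℕ => (ContinuousLinearMap.apply ℂ V w)
      ((m.factorial : ℂ)⁻¹ • A ^ m)) w := by
    convert hasSum_single (f := fun m : ℕ => (ContinuousLinearMap.apply ℂ V w)
      ((m.factorial : ℂ)⁻¹ • A ^ m)) 0 ?_ using 1
    · simp
    · intro m hm
      obtain ⟨m, rfl⟩ := Nat.exists_eq_succ_of_ne_zero hm
      simp [pow_succ, h]
  exact h2.unique h3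

theorem exp_prod_fst (X : Matrix (Fin n) (Fin n) ℂ × (V →L[ℂ] V)) : (exp X).1 = exp X.1 := by
  let _ : NormedAlgebra ℚ (Matrix (Fin n) (Fin n) ℂ) := NormedAlgebra.restrictScalars ℚ ℂ _
  let _ : NormedAlgebra ℚ (V →L[ℂ] V) := NormedAlgebra.restrictScalars ℚ ℂ _
  exact Prod.fst_exp X

theorem exp_prod_snd (X : Matrix (Fin n) (Fin n) ℂ × (V →L[ℂ] V)) : (exp X).2 = exp X.2 := by
  let _ : NormedAlgebra ℚ (Matrix (Fin n) (Fin n) ℂ) := NormedAlgebra.restrictScalars ℚ ℂ _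
  let _ : NormedAlgebra ℚ (V →L[ℂ] V) := NormedAlgebra.restrictScalars ℚ ℂ _
  exact Prod.snd_exp X

/-- When `A` is controlled by `A w`, the remainder `exp A - 1 - A`, which is `o(‖A‖)`, costs at most
half of `‖A w‖`. -/
theorem exists_norm_le_two_mul_exp_sub_self (w : V) {C : ℝ} (hC : 0 < C) :
    ∃ η > 0, ∀ A : V →L[ℂ] V, ‖A‖ < η → ‖A‖ ≤ C * ‖A w‖ → ‖A w‖ ≤ 2 * ‖exp A w - w‖ := by
  have h := (hasFDerivAt_exp_zero (𝕂 := ℂ) (𝔸 := V →L[ℂ] V)).isLittleO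
  have hε : 0 < 1 / (2 * C * (‖w‖ + 1)) := by positivity
  obtain ⟨η, hη, hball⟩ := Metric.eventually_nhds_iff.1 (h.def hε)
  refine ⟨η, hη, fun A hA hAw => ?_⟩
  have h1 := hball (y := A) (by simpa using hA)
  simp only [exp_zero, sub_zero, one_apply_eq_self] at h1
  have h2 : ‖(exp A - 1 - A) w‖ ≤ ‖A w‖ / 2 := by
    calc ‖(exp A - 1 - A) w‖ ≤ ‖exp A - 1 - A‖ * ‖w‖ := ContinuousLinearMap.le_opNorm _ _
      _ ≤ (1 / (2 * C * (‖w‖ + 1)) * (C * ‖A w‖)) * (‖w‖ + 1) := by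
          gcongr
          · exact h1.trans (by gcongr)
          · linarith
      _ = ‖A w‖ / 2 := by field_simp
  have h3 : A w = (exp A w - w) - (exp A - 1 - A) w := by simp
  have h4 : ‖A w‖ ≤ ‖exp A w - w‖ + ‖(exp A - 1 - A) w‖ := by
    conv_lhs => rw [h3]
    exact norm_sub_le _ _
  linarith

variable (hG : IsComplexification K G) (hφ : IsRationalRep φ)
  (hinv : ∀ g : G, g.1 ∈ K → ∀ x y : V, inner ℂ (φ g x) (φ g y) = inner ℂ x y)
  {w : V} (hmin : ∀ g : G, ‖w‖ ≤ ‖φ g w‖)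

include hG hφ hinv hmin

/-- Near `1` an element of the graph is `exp X * exp S` with `S` killing `w`, so it acts on `w` as
`exp A`, where `A = X.2`. The phase is then `O(‖A‖ ^ 3)`, and `‖A‖ ≤ C ‖A w‖ ≤ 2 C ‖exp A w - w‖`.
Working in the graph carries the matrix `X.1` and its image `X.2` under the differential of `φ`
together. -/
theorem eventually_abs_im_inner_le :
    ∃ C : ℝ, 0 < C ∧ ∀ᶠ g in 𝓝 (1 : Matrix (Fin n) (Fin n) ℂ × (V →L[ℂ] V)),
      g ∈ graphOver K φ → |(inner ℂ w (g.2 w)).im| ≤ C * ‖g.2 w - w‖ ^ 3 := by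
  have hL := (isCompact_graphOver hG hφ).isClosed
  let ev : Matrix (Fin n) (Fin n) ℂ × (V →L[ℂ] V) →ₗ[ℝ] V :=
    { toFun := fun X => X.2 w, map_add' := fun _ _ => rfl, map_smul' := fun _ _ => rfl }
  obtain ⟨C, hC, hdec⟩ := eventually_exists_exp_mul_exp hL
    (fun x hx y hxy => inv_mem_graphOver hx hxy) ev
  obtain ⟨η₁, hη₁, hlow⟩ := exists_norm_le_two_mul_exp_sub_self w hC
  obtain ⟨C₂, hC₂, hcub⟩ := exists_norm_exp_sub_exp_neg_le (V →L[ℂ] V)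
  obtain ⟨η₂, hη₂, hcub⟩ := Metric.eventually_nhds_iff.1 hcub
  refine ⟨(‖w‖ ^ 2 + 1) * (C₂ * (2 * C) ^ 3), by positivity, ?_⟩
  filter_upwards [hdec (min η₁ η₂) (lt_min hη₁ hη₂)] with g hg hgL
  obtain ⟨X, hX, S, hS, hSw, hgE, hXC, hXη⟩ := hg hgL
  have hX2 : ‖X.2‖ ≤ ‖X‖ := norm_snd_le X
  have hgw : g.2 w = exp X.2 w := by
    have h1 : (exp X).2 ((exp S).2 w) = exp X.2 w := by
      rw [exp_prod_snd, exp_prod_snd, exp_apply_eq_self hSw]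
    rw [hgE]
    exact h1
  rw [hgw]
  have hone : ∀ t : ℝ, ∃ g : G, g.1 ∈ K ∧ (g.1 : Matrix (Fin n) (Fin n) ℂ) = exp (t • X.1) ∧
      ∀ x, φ g x = exp (t • X.2) x := fun t => by
    obtain ⟨g, hg, hgX⟩ := hX t
    refine ⟨g, hg, ?_, fun x => ?_⟩
    · exact (congrArg Prod.fst hgX).trans (exp_prod_fst (t • X))
    · exact (congrArg (fun Y => Y.2 x) hgX).trans
        (congrArg (fun B : V →L[ℂ] V => B x) (exp_prod_snd (t • X)))
  have hmom : (inner ℂ w (X.2 w)).im = 0 := im_inner_apply_eq_zero fun z => by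
    obtain ⟨g, hg⟩ := exists_rep_eq_exp_smul hG.isLinearAlgebraic hφ
      (fun t => (hone t).imp fun g hg => hg.2) z
    rw [← hg]
    exact hmin g
  have huni : ∀ x y, inner ℂ (exp X.2 x) (exp X.2 y) = inner ℂ x y := fun x y => by
    obtain ⟨g, hg, -, hgA⟩ := hone 1
    rw [one_smul] at hgA
    rw [← hgA, ← hgA, hinv g hg]
  have h1 : ‖X.2‖ < η₁ := hX2.trans_lt (hXη.trans_le (min_le_left _ _))
  have h2 : ‖X.2‖ < η₂ := hX2.trans_lt (hXη.trans_le (min_le_right _ _))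
  have h3 : ‖X.2‖ ≤ C * ‖X.2 w‖ := hX2.trans hXC
  have h4 := hlow X.2 h1 h3
  have h5 := hcub (y := X.2) (by simpa using h2)
  calc _ ≤ ‖w‖ ^ 2 * ‖exp X.2 - exp (-X.2) - (2 : ℂ) • X.2‖ := abs_im_inner_exp_le huni hmom
    _ ≤ (‖w‖ ^ 2 + 1) * (C₂ * ‖X.2‖ ^ 3) := by gcongr; linarith
    _ ≤ (‖w‖ ^ 2 + 1) * (C₂ * (C * (2 * ‖exp X.2 w - w‖)) ^ 3) := by
        gcongr; exact h3.trans (by gcongr)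
    _ = _ := by ring

/-- At a vector `w` of minimal norm in its orbit, the phase of `⟪w, k w⟫` is of third order in
the displacement `k w - w`. -/
theorem exists_abs_im_inner_le :
    ∃ C : ℝ, 0 < C ∧ ∃ δ > 0, ∀ g : G, g.1 ∈ K → ‖φ g w - w‖ < δ →
      |(inner ℂ w (φ g w)).im| ≤ C * ‖φ g w - w‖ ^ 3 := by
  obtain ⟨C, hC, hev⟩ := eventually_abs_im_inner_le hG hφ hinv hmin
  refine ⟨C, hC, ?_⟩
  by_contra! hcon
  have : FirstCountableTopology (Matrix (Fin n) (Fin n) ℂ) :=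
    inferInstanceAs (FirstCountableTopology (Fin n → Fin n → ℂ))
  choose g hgK hgδ hgC using fun j : ℕ => hcon (1 / ((j : ℝ) + 1)) (by positivity)
  obtain ⟨s, hs, σ, hσ, hlim⟩ := (isCompact_graphOver hG hφ).tendsto_subseq
    (x := fun j => graphHom φ (g j)) (fun j => ⟨g j, hgK j, rfl⟩)
  obtain ⟨g₀, hg₀, rfl⟩ := hs
  have hconv : Tendsto (fun j => φ (g (σ j)) w) atTop (𝓝 (φ g₀ w)) := by
    have h1 : Continuous fun X : Matrix (Fin n) (Fin n) ℂ × (V →L[ℂ] V) => X.2 w := by fun_prop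
    exact (h1.tendsto _).comp hlim
  have hw : φ g₀ w = w := by
    refine tendsto_nhds_unique hconv ?_
    rw [tendsto_iff_norm_sub_tendsto_zero]
    refine squeeze_zero (fun _ => norm_nonneg _) (fun j => (hgδ (σ j)).le) ?_
    exact tendsto_one_div_add_atTop_nhds_zero_nat.comp hσ.tendsto_atTop
  -- Counterexamples accumulate at some `g₀` fixing `w`. Right translation by `g₀⁻¹` moves them near
  -- `1` without changing their action on `w`.
  have hw' : φ g₀⁻¹ w = w := by
    conv_lhs => rw [← hw]
    rw [← Module.End.mul_apply, ← map_mul, inv_mul_cancel, map_one, Module.End.one_apply]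
  have hone : Tendsto (fun j => graphHom φ (g (σ j) * g₀⁻¹)) atTop (𝓝 1) := by
    have := hlim.mul_const (graphHom φ g₀⁻¹)
    rw [← map_mul, mul_inv_cancel, map_one] at this
    refine this.congr fun j => ?_
    rw [map_mul]; rfl
  obtain ⟨j, hj⟩ := (hone.eventually hev).exists
  have h1 := hj ⟨_, (K.subgroupOf G).mul_mem (hgK _) ((K.subgroupOf G).inv_mem hg₀), rfl⟩
  have h2 : (graphHom φ (g (σ j) * g₀⁻¹)).2 w = φ (g (σ j)) w := by
    change φ (g (σ j) * g₀⁻¹) w = _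
    rw [map_mul, Module.End.mul_apply, hw']
  rw [h2] at h1
  exact absurd h1 (not_le.2 (hgC _))

end Graph

end

section

open Filter Topology MeasureTheory

/-! ### Laplace's method on a compact group. -/

section Laplace

variable {Γ : Type*} [Group Γ] [TopologicalSpace Γ] [CompactSpace Γ]
  [MeasurableSpace Γ] [BorelSpace Γ] {μ : Measure Γ} [IsProbabilityMeasure μ]

omit [Group Γ] in
theorem Continuous.integrable_of_compactSpace {E : Type*} [NormedAddCommGroup E]
    [SecondCountableTopology E] {f : Γ → E} (hf : Continuous f) : Integrable f μ := by
  obtain ⟨M, hM⟩ := (isCompact_range hf).isBounded.exists_norm_le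
  exact Integrable.of_bound hf.aestronglyMeasurable M
    (Eventually.of_forall fun k => hM _ ⟨k, rfl⟩)

omit [Group Γ] in
-- The exponential series is integrated term by term, which is legitimate because `f` is bounded.
theorem norm_integral_exp_le {f : Γ → ℂ} (hf : Continuous f) {C B : ℝ}
    (hfm : ∀ m : ℕ, ‖∫ k, f k ^ m ∂μ‖ ≤ C * B ^ m) {t : ℝ} (ht : 0 ≤ t) :
    ‖∫ k, Complex.exp (t * f k) ∂μ‖ ≤ C * Real.exp (t * B) := by
  obtain ⟨M, hM⟩ := (isCompact_range hf).isBounded.exists_norm_le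
  have hM' : ∀ k, ‖f k‖ ≤ M := fun k => hM _ ⟨k, rfl⟩
  have hsum : HasSum (fun m : ℕ => ∫ k, (t * f k) ^ m / (m.factorial : ℂ) ∂μ)
      (∫ k, Complex.exp (t * f k) ∂μ) := by
    refine hasSum_integral_of_dominated_convergence
      (fun m _ => (t * M) ^ m / (m.factorial : ℝ)) (fun m => ?_) (fun m => ?_) ?_ ?_ ?_
    · exact Continuous.aestronglyMeasurable (by fun_prop)
    · refine Eventually.of_forall fun k => ?_
      rw [norm_div, norm_pow, norm_mul, Complex.norm_natCast, Complex.norm_real,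
        Real.norm_of_nonneg ht]
      have := hM' k
      gcongr
    · exact Eventually.of_forall fun k => Real.summable_pow_div_factorial _
    · exact integrable_const _
    · refine Eventually.of_forall fun k => ?_
      rw [Complex.exp_eq_exp_ℂ]
      exact NormedSpace.expSeries_div_hasSum_exp _
  have hexp : HasSum (fun m : ℕ => C * ((t * B) ^ m / (m.factorial : ℝ)))
      (C * Real.exp (t * B)) := by
    rw [Real.exp_eq_exp_ℝ]
    exact (NormedSpace.expSeries_div_hasSum_exp (t * B)).mul_left C
  refine hsum.norm_le_of_bounded hexp fun m => ?_
  have h1 : ∫ k, (t * f k) ^ m / (m.factorial : ℂ) ∂μ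
      = (t : ℂ) ^ m / (m.factorial : ℂ) * ∫ k, f k ^ m ∂μ := by
    rw [← integral_const_mul]
    congr 1
    ext k
    ring
  rw [h1, norm_mul, norm_div, norm_pow, Complex.norm_natCast, Complex.norm_real,
    Real.norm_of_nonneg ht]
  calc _ ≤ t ^ m / (m.factorial : ℝ) * (C * B ^ m) := by gcongr; exact hfm m
    _ = _ := by ring

variable {V : Type*} [NormedAddCommGroup V] [InnerProductSpace ℂ V] [FiniteDimensional ℂ V]
  {ρ : Representation ℂ Γ V} {w : V}

/-- The set of group elements moving `w` by at most `r` has measure at least a power of `r`. -/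
theorem exists_pow_le_measureReal [IsTopologicalGroup Γ] [μ.IsMulLeftInvariant] (hρ : ∀ k x, ‖ρ k x‖ = ‖x‖)
    (hc : Continuous fun k => ρ k w) :
    ∃ c > 0, ∃ N : ℕ, ∀ r : ℝ, 0 < r → r ≤ 1 → c * r ^ N ≤ μ.real {k | ‖ρ k w - w‖ ≤ r} := by
  let _ : MeasurableSpace V := borel V
  have : BorelSpace V := ⟨rfl⟩
  have : FiniteDimensional ℝ V := FiniteDimensional.complexToReal V
  have : ProperSpace V := FiniteDimensional.proper ℂ V
  let ν : Measure V := Measure.addHaar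
  set N := Module.finrank ℝ V
  set b := ν.real (Metric.ball 0 1) with hb
  set B := ν.real (Metric.closedBall 0 (‖w‖ + 1)) with hB
  have hb0 : 0 < b := ENNReal.toReal_pos (Metric.measure_ball_pos ν 0 one_pos).ne'
    measure_ball_lt_top.ne
  have hB0 : 0 < B := ENNReal.toReal_pos
    (Metric.measure_closedBall_pos ν 0 (by positivity)).ne' measure_closedBall_lt_top.ne
  refine ⟨b / B * (1 / 2) ^ N, by positivity, N, fun r hr hr1 => ?_⟩
  -- The measure of `S` is computed in both orders. Slices over `Γ` are balls of radius `r / 2`;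
  -- slices over `V` lie in left translates of the set to be measured, and are empty outside radius
  -- `‖w‖ + 1`.
  set S : Set (Γ × V) := {p | ‖ρ p.1 w - p.2‖ ≤ r / 2} with hS
  have hSm : MeasurableSet S := by
    have h1 : Measurable fun p : Γ × V => ρ p.1 w := hc.measurable.comp measurable_fst
    exact measurableSet_le (h1.sub measurable_snd).norm measurable_const
  have e1 : (μ.prod ν) S = ENNReal.ofReal ((r / 2) ^ N * b) := by
    rw [Measure.prod_apply hSm]
    have h1 : ∀ k : Γ, ν (Prod.mk k ⁻¹' S) = ENNReal.ofReal ((r / 2) ^ N * b) := fun k => by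
      have h2 : Prod.mk k ⁻¹' S = Metric.closedBall (ρ k w) (r / 2) := by
        ext x
        simp only [hS, Set.mem_preimage, Set.mem_ofPred_eq, Metric.mem_closedBall, dist_eq_norm]
        rw [norm_sub_rev]
      rw [h2, Measure.addHaar_closedBall _ _ (by positivity), ENNReal.ofReal_mul (by positivity), hb,
        Measure.real, ENNReal.ofReal_toReal measure_ball_lt_top.ne]
    simp only [h1, lintegral_const, measure_univ, mul_one]
  have e2 : (μ.prod ν) S ≤ μ {k | ‖ρ k w - w‖ ≤ r} * ν (Metric.closedBall 0 (‖w‖ + 1)) := by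
    rw [Measure.prod_apply_symm hSm]
    calc _ ≤ ∫⁻ x, (Metric.closedBall (0 : V) (‖w‖ + 1)).indicator
          (fun _ => μ {k | ‖ρ k w - w‖ ≤ r}) x ∂ν := by
          refine lintegral_mono fun x => ?_
          by_cases hne : ∃ k₀, ‖ρ k₀ w - x‖ ≤ r / 2
          · obtain ⟨k₀, hk₀⟩ := hne
            have hx : x ∈ Metric.closedBall (0 : V) (‖w‖ + 1) := by
              rw [mem_closedBall_zero_iff]
              have h1 : ‖x‖ ≤ ‖ρ k₀ w‖ + ‖ρ k₀ w - x‖ := by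
                have h3 : x = ρ k₀ w - (ρ k₀ w - x) := by abel
                conv_lhs => rw [h3]
                exact norm_sub_le _ _
              rw [hρ] at h1
              linarith
            rw [Set.indicator_of_mem hx]
            have hsub : (fun k => (k, x)) ⁻¹' S ⊆ (fun k => k₀⁻¹ * k) ⁻¹' {k | ‖ρ k w - w‖ ≤ r} := by
              intro k hk
              simp only [hS, Set.mem_preimage, Set.mem_ofPred_eq] at hk ⊢
              have h1 : ρ (k₀⁻¹ * k) w - w = ρ k₀⁻¹ (ρ k w - ρ k₀ w) := by
                rw [map_sub, ← Module.End.mul_apply, ← map_mul, ← Module.End.mul_apply, ← map_mul,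
                  inv_mul_cancel, map_one, Module.End.one_apply]
              rw [h1, hρ]
              calc ‖ρ k w - ρ k₀ w‖ = ‖(ρ k w - x) - (ρ k₀ w - x)‖ := by congr 1; abel
                _ ≤ ‖ρ k w - x‖ + ‖ρ k₀ w - x‖ := norm_sub_le _ _
                _ ≤ r := by linarith
            exact (measure_mono hsub).trans_eq (measure_preimage_mul μ _ _)
          · have : (fun k => (k, x)) ⁻¹' S = ∅ := by
              ext k
              simp only [hS, Set.mem_preimage, Set.mem_ofPred_eq, Set.mem_empty_iff_false, iff_false]
              exact fun h => hne ⟨k, h⟩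
            rw [this, measure_empty]
            exact zero_le
      _ = _ := by
          rw [lintegral_indicator Metric.isClosed_closedBall.measurableSet, lintegral_const,
            Measure.restrict_apply_univ]
  rw [e1] at e2
  have e3 := ENNReal.toReal_mono (ENNReal.mul_ne_top (measure_ne_top _ _)
    measure_closedBall_lt_top.ne) e2
  rw [ENNReal.toReal_ofReal (by positivity), ENNReal.toReal_mul] at e3
  change (r / 2) ^ N * b ≤ μ.real _ * B at e3
  rw [← div_le_iff₀ hB0] at e3
  refine le_trans (le_of_eq ?_) e3
  rw [div_pow, div_pow, one_pow]
  field_simp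

omit [FiniteDimensional ℂ V] in
theorem re_inner_eq_sub_norm_sq {x w : V} (h : ‖x‖ = ‖w‖) :
    (inner ℂ w x).re = ‖w‖ ^ 2 - ‖x - w‖ ^ 2 / 2 := by
  have h1 := norm_sub_sq (𝕜 := ℂ) x w
  have h2 : RCLike.re (inner ℂ x w) = (inner ℂ w x).re := by
    rw [← inner_conj_symm]; exact Complex.conj_re _
  rw [h2, h] at h1
  linarith

omit [FiniteDimensional ℂ V] in
-- Here `t = s ^ 10`, which makes the scales integral powers. Up to distance `s⁻⁴` the phase is at
-- most `C / s ^ 2 ≤ 1`, so the cosine is at least `1 / 2`. Up to `s⁻⁵ = t ^ (-1/2)` the Gaussian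
-- factor is at least `exp (-1/2)`. Beyond `s⁻⁴` it is at most `exp (-s ^ 2 / 2)`.
theorem re_exp_inner_ge {C δ s : ℝ} (hC : 0 < C) {x w : V} (h : ‖x‖ = ‖w‖)
    (him : ‖x - w‖ < δ → |(inner ℂ w x).im| ≤ C * ‖x - w‖ ^ 3)
    (hs : 1 ≤ s) (hsδ : 1 < δ * s ^ 4) (hsC : C ≤ s ^ 2) :
    Real.exp (s ^ 10 * ‖w‖ ^ 2) * ((if ‖x - w‖ ≤ (s ^ 5)⁻¹ then Real.exp (-(1 / 2)) / 2 else 0)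
        - Real.exp (-(s ^ 2 / 2)))
      ≤ (Complex.exp ((s ^ 10 : ℝ) * inner ℂ w x)).re := by
  have hs0 : 0 < s := by linarith
  set D := ‖x - w‖ with hD
  have hD0 : 0 ≤ D := norm_nonneg _
  have hre : ((s ^ 10 : ℝ) * inner ℂ w x : ℂ).re = s ^ 10 * ‖w‖ ^ 2 - s ^ 10 * D ^ 2 / 2 := by
    rw [Complex.re_ofReal_mul, re_inner_eq_sub_norm_sq h]; ring
  have him' : ((s ^ 10 : ℝ) * inner ℂ w x : ℂ).im = s ^ 10 * (inner ℂ w x).im := by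
    rw [Complex.im_ofReal_mul]
  rw [Complex.exp_re, hre, him', sub_eq_add_neg (s ^ 10 * ‖w‖ ^ 2), Real.exp_add, mul_assoc]
  refine mul_le_mul_of_nonneg_left ?_ (Real.exp_pos _).le
  by_cases hR : D ≤ (s ^ 4)⁻¹
  · have hDδ : D < δ := by
      refine hR.trans_lt ?_
      rw [inv_lt_iff_one_lt_mul₀ (by positivity)]
      linarith
    have hphase : |s ^ 10 * (inner ℂ w x).im| ≤ 1 := by
      rw [abs_mul, abs_of_pos (by positivity)]
      calc _ ≤ s ^ 10 * (C * ((s ^ 4)⁻¹) ^ 3) := by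
            gcongr
            exact (him hDδ).trans (by gcongr)
        _ = C / s ^ 2 := by field_simp
        _ ≤ 1 := by rw [div_le_one (by positivity)]; exact hsC
    have hcos : 1 / 2 ≤ Real.cos (s ^ 10 * (inner ℂ w x).im) := by
      have h1 := Real.one_sub_sq_div_two_le_cos (x := s ^ 10 * (inner ℂ w x).im)
      have h2 := (sq_le_one_iff_abs_le_one _).2 hphase
      linarith
    have hpos := Real.exp_pos (-(s ^ 2 / 2))
    split_ifs with hr
    · have h3 : s ^ 10 * D ^ 2 / 2 ≤ 1 / 2 := by
        have : s ^ 10 * D ^ 2 ≤ s ^ 10 * ((s ^ 5)⁻¹) ^ 2 := by gcongr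
        have h4 : s ^ 10 * ((s ^ 5)⁻¹) ^ 2 = 1 := by field_simp
        linarith
      calc _ ≤ Real.exp (-(1 / 2)) * (1 / 2) := by linarith
        _ ≤ _ := by gcongr
    · have : 0 ≤ Real.exp (-(s ^ 10 * D ^ 2 / 2)) * Real.cos (s ^ 10 * (inner ℂ w x).im) := by
        have := Real.exp_pos (-(s ^ 10 * D ^ 2 / 2))
        positivity
      linarith
  · push Not at hR
    have hr : ¬ D ≤ (s ^ 5)⁻¹ := by
      intro hr
      have : (s ^ 5)⁻¹ ≤ (s ^ 4)⁻¹ := by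
        gcongr
        norm_num
      linarith
    rw [if_neg hr, zero_sub]
    have h3 : s ^ 2 ≤ s ^ 10 * D ^ 2 := by
      have : s ^ 10 * ((s ^ 4)⁻¹) ^ 2 ≤ s ^ 10 * D ^ 2 := by gcongr
      have h4 : s ^ 10 * ((s ^ 4)⁻¹) ^ 2 = s ^ 2 := by field_simp
      linarith
    have h5 : Real.exp (-(s ^ 10 * D ^ 2 / 2)) ≤ Real.exp (-(s ^ 2 / 2)) := by
      gcongr
    have h6 := Real.neg_one_le_cos (s ^ 10 * (inner ℂ w x).im)
    have h7 := Real.exp_pos (-(s ^ 10 * D ^ 2 / 2))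
    nlinarith

/-- Laplace's method: the moments of `⟪w, k w⟫` over the group grow at least like
`‖w‖ ^ (2 * m)`. -/
theorem not_norm_integral_inner_pow_le [IsTopologicalGroup Γ] [μ.IsMulLeftInvariant] (hρ : ∀ k x, ‖ρ k x‖ = ‖x‖)
    (hc : Continuous fun k => ρ k w) {C δ : ℝ} (hC : 0 < C) (hδ : 0 < δ)
    (him : ∀ k, ‖ρ k w - w‖ < δ → |(inner ℂ w (ρ k w)).im| ≤ C * ‖ρ k w - w‖ ^ 3)
    {C₀ B : ℝ} (hB : B < ‖w‖ ^ 2) :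
    ¬ ∀ m : ℕ, ‖∫ k, inner ℂ w (ρ k w) ^ m ∂μ‖ ≤ C₀ * B ^ m := by
  intro hm
  obtain ⟨c, hc0, N, hN⟩ := exists_pow_le_measureReal (μ := μ) hρ hc
  have hcont : Continuous fun k => inner ℂ w (ρ k w) := by fun_prop
  -- The central set has measure at least `c * s ^ (-5 N)`. Multiplying by `s ^ (5 N)` leaves a
  -- positive constant on the left, while the right side tends to `0`.
  have key : ∀ᶠ s : ℝ in atTop, Real.exp (-(1 / 2)) / 2 * c ≤
      s ^ (5 * N) * Real.exp (-(s ^ 2 / 2))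
        + C₀ * (s ^ (5 * N) * Real.exp (-(s ^ 10 * (‖w‖ ^ 2 - B)))) := by
    have h4 : Tendsto (fun s : ℝ => δ * s ^ 4) atTop atTop :=
      (tendsto_pow_atTop (by norm_num)).const_mul_atTop hδ
    have h2 : Tendsto (fun s : ℝ => s ^ 2) atTop atTop := tendsto_pow_atTop (by norm_num)
    filter_upwards [eventually_ge_atTop 1, h4.eventually_gt_atTop 1, h2.eventually_ge_atTop C]
      with s hs hsδ hsC
    have hs0 : 0 < s := by linarith
    have hup := norm_integral_exp_le hcont hm (t := s ^ 10) (by positivity)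
    have hint : Integrable (fun k => Complex.exp ((s ^ 10 : ℝ) * inner ℂ w (ρ k w))) μ :=
      Continuous.integrable_of_compactSpace (by fun_prop)
    have hre : (∫ k, Complex.exp ((s ^ 10 : ℝ) * inner ℂ w (ρ k w)) ∂μ).re
        = ∫ k, (Complex.exp ((s ^ 10 : ℝ) * inner ℂ w (ρ k w))).re ∂μ :=
      (integral_re hint).symm
    have hset : MeasurableSet {k | ‖ρ k w - w‖ ≤ (s ^ 5)⁻¹} :=
      (isClosed_le (by fun_prop) continuous_const).measurableSet
    have hif : (fun k => if ‖ρ k w - w‖ ≤ (s ^ 5)⁻¹ then Real.exp (-(1 / 2)) / 2 else 0)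
        = Set.indicator {k | ‖ρ k w - w‖ ≤ (s ^ 5)⁻¹} (fun _ => Real.exp (-(1 / 2)) / 2) := by
      ext k; simp [Set.indicator]
    have hifint : Integrable
        (fun k => if ‖ρ k w - w‖ ≤ (s ^ 5)⁻¹ then Real.exp (-(1 / 2)) / 2 else 0) μ := by
      rw [hif]; exact (integrable_const _).indicator hset
    have hlow : ∫ k, Real.exp (s ^ 10 * ‖w‖ ^ 2) *
        ((if ‖ρ k w - w‖ ≤ (s ^ 5)⁻¹ then Real.exp (-(1 / 2)) / 2 else 0)
          - Real.exp (-(s ^ 2 / 2))) ∂μ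
        ≤ ∫ k, (Complex.exp ((s ^ 10 : ℝ) * inner ℂ w (ρ k w))).re ∂μ :=
      integral_mono ((hifint.sub (integrable_const _)).const_mul _) hint.re fun k =>
        re_exp_inner_ge hC (hρ k w) (him k) hs hsδ hsC
    rw [integral_const_mul, integral_sub hifint (integrable_const _), hif,
      integral_indicator_const _ hset, integral_const, probReal_univ, one_smul, smul_eq_mul,
      ← hre] at hlow
    have h5 := hlow.trans ((Complex.re_le_norm _).trans hup)
    have h6 : C₀ * Real.exp (s ^ 10 * B)
        = Real.exp (s ^ 10 * ‖w‖ ^ 2) * (C₀ * Real.exp (-(s ^ 10 * (‖w‖ ^ 2 - B)))) := by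
      rw [mul_left_comm, ← Real.exp_add]
      congr 2; ring
    rw [h6] at h5
    have h7 := le_of_mul_le_mul_left h5 (Real.exp_pos _)
    have h8 := hN (s ^ 5)⁻¹ (by positivity) (inv_le_one_of_one_le₀ (one_le_pow₀ hs))
    have h9 : c * ((s ^ 5)⁻¹) ^ N * (Real.exp (-(1 / 2)) / 2) ≤
        Real.exp (-(s ^ 2 / 2)) + C₀ * Real.exp (-(s ^ 10 * (‖w‖ ^ 2 - B))) := by
      have : c * ((s ^ 5)⁻¹) ^ N * (Real.exp (-(1 / 2)) / 2)
        ≤ μ.real {k | ‖ρ k w - w‖ ≤ (s ^ 5)⁻¹} * (Real.exp (-(1 / 2)) / 2) := by gcongr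
      linarith
    have h10 := mul_le_mul_of_nonneg_left h9 (by positivity : 0 ≤ s ^ (5 * N))
    refine le_trans (le_of_eq ?_) (h10.trans (le_of_eq (by ring)))
    rw [inv_pow, ← pow_mul]
    field_simp
  have hlim : ∀ (ε : ℝ), 0 < ε → ∀ p : ℕ, 1 ≤ p →
      Tendsto (fun s : ℝ => s ^ (5 * N) * Real.exp (-(s ^ p * ε))) atTop (𝓝 0) := by
    intro ε hε p hp
    have h1 := tendsto_rpow_mul_exp_neg_mul_atTop_nhds_zero ((5 * N : ℕ) : ℝ) ε hε
    refine squeeze_zero' ?_ ?_ h1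
    · filter_upwards [eventually_ge_atTop 0] with s hs
      positivity
    · filter_upwards [eventually_ge_atTop 1] with s hs
      rw [Real.rpow_natCast]
      have : s ≤ s ^ p := le_self_pow₀ hs (by omega)
      gcongr
      nlinarith
  have hl1 := hlim (1 / 2) (by norm_num) 2 (by norm_num)
  have hl2 := (hlim (‖w‖ ^ 2 - B) (by linarith) 10 (by norm_num)).const_mul C₀
  have hl := hl1.add hl2
  simp only [mul_one_div, mul_zero, add_zero] at hl
  have := ge_of_tendsto hl key
  have hpos : 0 < Real.exp (-(1 / 2)) / 2 * c := by positivity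
  linarith

end Laplace

end

open Filter Topology MeasureTheory

/-! ### The projection as an average over `K`. -/

namespace TensorPow

variable {n : ℕ} {K G : Subgroup (Matrix.GeneralLinearGroup (Fin n) ℂ)}
  {V : Type*} [NormedAddCommGroup V] [InnerProductSpace ℂ V] [FiniteDimensional ℂ V]
  {φ : Representation ℂ G V}

theorem continuous_rep_apply (hφ : IsRationalRep φ) {m : ℕ} (x : TensorPow V m) :
    Continuous fun g : G => rep φ m g x := by
  have h : ∀ g, rep φ m g x = ∑ i, inner ℂ (stdOrthonormalBasis ℂ (TensorPow V m) i) (rep φ m g x) •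
      stdOrthonormalBasis ℂ (TensorPow V m) i := fun g =>
    ((stdOrthonormalBasis ℂ (TensorPow V m)).sum_repr' (rep φ m g x)).symm
  rw [funext h]
  exact continuous_finsetSum _ fun i _ =>
    (isRegularFun_inner_rep hφ _ x).continuous.smul continuous_const

variable (hG : IsComplexification K G) (hφ : IsRationalRep φ)
  (hinv : ∀ g : G, g.1 ∈ K → ∀ x y : V, inner ℂ (φ g x) (φ g y) = inner ℂ x y)
  [MeasurableSpace K] [BorelSpace K] [CompactSpace K]
  (μ : Measure K) [IsProbabilityMeasure μ] [μ.IsMulLeftInvariant]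

include hG hφ hinv

/-- The projection onto the invariants of `G` is the average over `K`. -/
theorem invariantProj_eq_integral {m : ℕ} (x : TensorPow V m) :
    invariantProj φ m x = ∫ k, rep φ m (Subgroup.inclusion hG.le k) x ∂μ := by
  have : CompleteSpace (TensorPow V m) := FiniteDimensional.complete ℂ _
  have : SecondCountableTopology (TensorPow V m) :=
    have := FiniteDimensional.proper ℂ (TensorPow V m)
    inferInstance
  have hcι : Continuous (Subgroup.inclusion hG.le) :=
    Continuous.subtype_mk continuous_subtype_val _
  have hint : Integrable (fun k => rep φ m (Subgroup.inclusion hG.le k) x) μ :=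
    Continuous.integrable_of_compactSpace ((continuous_rep_apply hφ x).comp hcι)
  refine Submodule.eq_starProjection_of_mem_orthogonal ?_ ?_
  · refine mem_invariants_of_forall_mem hG hφ fun g hg => ?_
    have h1 := ((LinearMap.toContinuousLinearMap (rep φ m g)).integral_comp_comm hint).symm
    refine (h1.trans ?_)
    have h2 : ∀ k : K, rep φ m g (rep φ m (Subgroup.inclusion hG.le k) x)
        = rep φ m (Subgroup.inclusion hG.le (⟨g.1, hg⟩ * k)) x := fun k => by
      rw [← Module.End.mul_apply, ← map_mul]; rfl
    simp only [LinearMap.coe_toContinuousLinearMap', h2]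
    exact integral_mul_left_eq_self (fun k => rep φ m (Subgroup.inclusion hG.le k) x) _
  · rw [Submodule.mem_orthogonal]
    intro u hu
    rw [inner_sub_right, ← integral_inner hint]
    simp only [inner_rep_of_mem_invariants hG hφ hinv hu, integral_const, probReal_univ, one_smul,
      sub_self]

/-- The integrand is `⟪x, k x⟫` for the pure tensor `x`, so the integral is `⟪x, Π x⟫ = ‖Π x‖ ^ 2`,
as `Π` is a self-adjoint idempotent. -/
theorem integral_inner_pow_eq (w : V) (m : ℕ) :
    ∫ k, inner ℂ w (φ (Subgroup.inclusion hG.le k) w) ^ m ∂μ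
      = ((‖invariantProj φ m (pure fun _ => w)‖ ^ 2 : ℝ) : ℂ) := by
  have : CompleteSpace (TensorPow V m) := FiniteDimensional.complete ℂ _
  have : SecondCountableTopology (TensorPow V m) :=
    have := FiniteDimensional.proper ℂ (TensorPow V m)
    inferInstance
  set x : TensorPow V m := pure fun _ => w with hx
  have hcι : Continuous (Subgroup.inclusion hG.le) :=
    Continuous.subtype_mk continuous_subtype_val _
  have hint : Integrable (fun k => rep φ m (Subgroup.inclusion hG.le k) x) μ :=
    Continuous.integrable_of_compactSpace ((continuous_rep_apply hφ x).comp hcι)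
  have h1 : inner ℂ x (invariantProj φ m x)
      = ∫ k, inner ℂ w (φ (Subgroup.inclusion hG.le k) w) ^ m ∂μ := by
    rw [invariantProj_eq_integral hG hφ hinv μ, ← integral_inner hint]
    congr 1
    ext k
    rw [hx, rep_pure, inner_pure, Finset.prod_const, Finset.card_univ, Fintype.card_fin]
  have h2 : inner ℂ x (invariantProj φ m x)
      = inner ℂ (invariantProj φ m x) (invariantProj φ m x) := by
    have h3 : invariantProj φ m x = invariantProj φ m (invariantProj φ m x) :=
      (Submodule.starProjection_eq_self_iff.2 (Submodule.starProjection_apply_mem _ x)).symm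
    conv_lhs => rw [h3]
    exact (Submodule.inner_starProjection_left_eq_right _ _ _).symm
  rw [← h1, h2, inner_self_eq_norm_sq_to_K]
  push_cast
  rfl

end TensorPow

/-! ### The lower bound and the conclusion. -/

section MinimalNorm

variable {n : ℕ} {K G : Subgroup (Matrix.GeneralLinearGroup (Fin n) ℂ)}
  {V : Type*} [NormedAddCommGroup V] [InnerProductSpace ℂ V] [FiniteDimensional ℂ V]
  {φ : Representation ℂ G V}

/-- If `w` has minimal norm in its orbit, then the norms of the invariant parts of its tensor
powers do not decay exponentially faster than `‖w‖ ^ m`. -/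
theorem not_norm_invariantProj_pure_le (hG : IsComplexification K G) (hφ : IsRationalRep φ)
    (hinv : ∀ g : G, g.1 ∈ K → ∀ x y : V, inner ℂ (φ g x) (φ g y) = inner ℂ x y)
    {w : V} (hmin : ∀ g : G, ‖w‖ ≤ ‖φ g w‖) {b C : ℝ} (hb0 : 0 ≤ b) (hb : b < ‖w‖) :
    ¬ ∀ m : ℕ, ‖TensorPow.invariantProj φ m (TensorPow.pure fun _ => w)‖ ≤ C * b ^ m := by
  intro hm
  let _ : MeasurableSpace K := borel K
  have : BorelSpace K := ⟨rfl⟩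
  have : CompactSpace K := isCompact_iff_compactSpace.1 hG.isCompact
  let μ : Measure K := Measure.haarMeasure ⊤
  have : IsProbabilityMeasure μ := ⟨Measure.haarMeasure_self⟩
  obtain ⟨C', hC', δ, hδ, him⟩ := exists_abs_im_inner_le hG hφ hinv hmin
  let ρ : Representation ℂ K V := φ.comp (Subgroup.inclusion hG.le)
  have hρ : ∀ k x, ‖ρ k x‖ = ‖x‖ := fun k x => by
    have h1 := hinv (Subgroup.inclusion hG.le k) k.2 x x
    rw [inner_self_eq_norm_sq_to_K, inner_self_eq_norm_sq_to_K] at h1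
    have h2 : ‖ρ k x‖ ^ 2 = ‖x‖ ^ 2 := by exact_mod_cast h1
    exact (pow_left_inj₀ (norm_nonneg _) (norm_nonneg _) two_ne_zero).1 h2
  have hc : Continuous fun k => ρ k w :=
    (hφ.continuous_apply w).comp (Continuous.subtype_mk continuous_subtype_val _)
  refine not_norm_integral_inner_pow_le (μ := μ) hρ hc hC' hδ
    (fun k => him (Subgroup.inclusion hG.le k) k.2) (C₀ := C ^ 2) (B := b ^ 2)
    (by gcongr) fun m => ?_
  have h1 := TensorPow.integral_inner_pow_eq hG hφ hinv μ w m
  refine (congrArg norm h1).trans_le ?_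
  rw [Complex.norm_real, Real.norm_of_nonneg (by positivity)]
  calc _ ≤ (C * b ^ m) ^ 2 := by gcongr; exact hm m
    _ = _ := by ring

end MinimalNorm

/-- The Laplace integral sums over every `m`, so the finitely many early terms are absorbed into the
constant. -/
theorem exists_mul_pow_bound_of_eventually {u : ℕ → ℝ} {a b : ℝ} (hb : 0 < b) (hba : b ≤ a)
    (hu : ∀ m, u m ≤ a ^ m) (hev : ∀ᶠ m in atTop, u m ≤ b ^ m) :
    ∃ C : ℝ, ∀ m, u m ≤ C * b ^ m := by
  obtain ⟨m₀, hm₀⟩ := eventually_atTop.1 hev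
  have h1 : 1 ≤ a / b := (one_le_div hb).2 hba
  refine ⟨(a / b) ^ m₀, fun m => ?_⟩
  rcases le_total m₀ m with hm | hm
  · exact (hm₀ m hm).trans (le_mul_of_one_le_left (by positivity) (one_le_pow₀ h1))
  · calc u m ≤ a ^ m := hu m
      _ = (a / b) ^ m * b ^ m := by rw [← mul_pow, div_mul_cancel₀ _ hb.ne']
      _ ≤ (a / b) ^ m₀ * b ^ m := by gcongr

theorem theorem1 {n : ℕ} (K G : Subgroup (Matrix.GeneralLinearGroup (Fin n) ℂ))
    (hG : IsComplexification K G)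
    (hK : IsConnected (K : Set (Matrix.GeneralLinearGroup (Fin n) ℂ)))
    {V : Type*} [NormedAddCommGroup V] [InnerProductSpace ℂ V] [FiniteDimensional ℂ V]
    (φ : Representation ℂ G V) (hφ : IsRationalRep φ)
    (hinv : ∀ g : G, g.1 ∈ K → ∀ x y : V, inner ℂ (φ g x) (φ g y) = inner ℂ x y)
    (v : V) :
    Filter.limsup
        (fun k : ℕ => ‖TensorPow.invariantProj φ k (TensorPow.pure fun _ => v)‖ ^ (1 / (k : ℝ)))
        Filter.atTop
      = (⨅ g : G, ‖φ g v‖) ∧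
    (⨅ g : G, ‖φ g v‖) = Metric.infDist 0 (closure (Set.range fun g : G => φ g v)) := by
  have hinf : (⨅ g : G, ‖φ g v‖) = Metric.infDist 0 (closure (Set.range fun g : G => φ g v)) := by
    rw [Metric.infDist_closure, Metric.infDist_eq_iInf, iInf_range']
    simp only [dist_zero_left]
  refine ⟨?_, hinf⟩
  have : ProperSpace V := FiniteDimensional.proper ℂ V
  have hne : (closure (Set.range fun g : G => φ g v)).Nonempty := (Set.range_nonempty _).closure
  obtain ⟨w, hw, hwd⟩ := isClosed_closure.exists_infDist_eq_dist hne (0 : V)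
  rw [dist_zero_left] at hwd
  have hmin : ∀ g : G, ‖w‖ ≤ ‖φ g w‖ := fun g => by
    have h1 : φ g w ∈ closure (Set.range fun g : G => φ g v) := by
      have hc : Continuous (φ g) := (LinearMap.toContinuousLinearMap (φ g)).continuous
      refine map_mem_closure hc hw ?_
      rintro _ ⟨g', rfl⟩
      exact ⟨g * g', by simp⟩
    rw [← hwd, ← dist_zero_left]
    exact Metric.infDist_le_dist_of_mem h1
  rw [hinf, hwd]
  simp only [← TensorPow.invariantProj_pure_eq_of_mem_closure hG hφ hinv hw]
  set u : ℕ → ℝ := fun k => ‖TensorPow.invariantProj φ k (TensorPow.pure fun _ => w)‖ with hu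
  have hu0 : ∀ k, 0 ≤ u k := fun k => norm_nonneg _
  have huw : ∀ k, u k ≤ ‖w‖ ^ k := fun k => TensorPow.norm_invariantProj_pure_le w
  have hroot : ∀ᶠ k : ℕ in atTop, u k ^ (1 / (k : ℝ)) ≤ ‖w‖ := by
    -- At `k = 0` the exponent `1 / 0` is `0` and the root is `1`, so that index is excluded.
    filter_upwards [eventually_gt_atTop 0] with k hk
    calc u k ^ (1 / (k : ℝ)) ≤ (‖w‖ ^ k) ^ (1 / (k : ℝ)) :=
          Real.rpow_le_rpow (hu0 k) (huw k) (by positivity)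
      _ = ‖w‖ := by rw [one_div, Real.pow_rpow_inv_natCast (norm_nonneg _) hk.ne']
  have hroot0 : ∀ k : ℕ, 0 ≤ u k ^ (1 / (k : ℝ)) := fun k => Real.rpow_nonneg (hu0 k) _
  have hbdd : IsBoundedUnder (· ≤ ·) atTop fun k : ℕ => u k ^ (1 / (k : ℝ)) := ⟨‖w‖, hroot⟩
  have hcobdd : IsCoboundedUnder (· ≤ ·) atTop fun k : ℕ => u k ^ (1 / (k : ℝ)) :=
    IsCoboundedUnder.of_frequently_ge (Frequently.of_forall hroot0)
  refine le_antisymm (limsup_le_of_le hcobdd hroot) ?_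
  by_contra! hlt
  obtain ⟨b, hb1, hb2⟩ := exists_between hlt
  have h0 : 0 ≤ limsup (fun k : ℕ => u k ^ (1 / (k : ℝ))) atTop :=
    le_limsup_of_frequently_le (Frequently.of_forall hroot0) hbdd
  have hb : 0 < b := h0.trans_lt hb1
  have hev : ∀ᶠ k : ℕ in atTop, u k ≤ b ^ k := by
    filter_upwards [eventually_lt_of_limsup_lt hb1 hbdd, eventually_gt_atTop 0] with k hk hk0
    calc u k = (u k ^ (1 / (k : ℝ))) ^ k := by
          rw [one_div, Real.rpow_inv_natCast_pow (hu0 k) hk0.ne']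
      _ ≤ b ^ k := pow_le_pow_left₀ (hroot0 k) hk.le k
  obtain ⟨C, hC⟩ := exists_mul_pow_bound_of_eventually hb hb2.le huw hev
  exact not_norm_invariantProj_pure_le hG hφ hinv hmin hb.le hb2 hC
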